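/- **Setting.** Let $\mathcal Q=[t_0,\infty)$. There are $n$ manipulators, with joint positions $q_i\in\mathbb R^{p_i}$ and task-space positions in $\mathbb R^m$, obeying $$H_i(q_i)\ddot q_i+C_i(q_i,\dot q_i)\dot q_i+g_i(q_i)+d_i(t)=u_i,\qquad x_i=\psi_i(q_i),\quad \dot x_i=J_i(q_i)\dot q_i,\quad J_i=\partial\psi_i/\partial q_i .$$ Here $H_i$ is $C^1$, $C_i$ and $g_i$ are continuous, $\psi_i$ is $C^2$; $H_i(q)$ is symmetric positive definite, $\dot H_i-2C_i$ is skew symmetric; $H_i,g_i,d_i$ are bounded and $\|C_i(q,\dot q)\|\le \bar c_i\|\dot q\|$; there are a continuous regressor $Y_i$ and a constant parameter vector $\vartheta_i$ with $H_i(q)x+C_i(q,\dot q)y+g_i(q)=Y_i(q,\dot q,y,x)\vartheta_i$ for all $x,y$, and for each $\hat\vartheta_i$ the estimates $\hat H_i,\hat C_i,\hat g_i$ satisfy $\hat H_i(q)x+\hat C_i(q,\dot q)y+\hat g_i(q)=Y_i(q,\dot q,y,x)\hat\vartheta_i$. On the set of possible (singularity-free) joint configurations, in which the joint positions stay, $J_i$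 has rank $m$ and $J_i$ and $J_i^\sharp=J_i^T(J_iJ_i^T)^{-1}$ are bounded. The interaction digraph has weights $\varepsilon_{ij}\ge 0$, $\varepsilon_{ii}=0$ ($\varepsilon_{ij}>0$ iff $i$ receives information from $j$, i.e. $j\in\mathcal N_i$), and the leader's weights are $b_i\ge0$ ($b_i>0$ iff $i$ receives the leader's state). The leader satisfies $\dot x_0=v_0$, $\dot v_0=a_0$, with $a_0$ differentiable. Assume (A1) the leader has a directed path to every node; (A2) $\sup_{t\in\mathcal Q}\|v_0\|_\infty<\beta_1$, $\sup_{t\in\mathcal Q}\|a_0\|_\infty<\beta_2$, $\sup_{t\in\mathcal Q}\|\dot a_0\|_\infty<\beta_3$. **Algorithm.** Let $\zeta_i=\mathrm{col}(\hat x_i,\hat v_i,\hat a_i)$ and $\zeta_0=\mathrm{col}(x_0,v_0,a_0)$. With the componentwise signum ($\mathrm{sgn}\,0=0$), the sliding-mode estimator is $$\dot\zeta_i=-(\mathrm{diag}(\beta_1,\beta_2,\beta_3)\otimes I_m)\,\mathrm{sgn}\Big(\sum_{j\in\mathcal N_i}\varepsilon_{ij}(\zeta_i-\zeta_j)+b_i(\zeta_i-\zeta_0)\Big).\tag{E}$$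 Let $\alpha_i>0$, let $\mathcal K_{xi},\mathcal K_{si},\mathcal K_{ri}$ be (symmetric) positive definite and $\mathcal T_i$ diagonal positive definite. Let the auxiliary vector $\varphi_i=\varphi_i(t,q_i)$ be $C^1$ and of at most linear growth in $q_i$, uniformly for $t$ in bounded intervals (for instance an exogenous $C^1$ signal $\varphi_i(t)$). Put $$\dot{\hat q}_{ri}=J_i^\sharp(\hat v_i-\alpha_i(x_i-\hat x_i))+(I-J_i^\sharp J_i)\varphi_i,$$ $$\ddot{\hat q}_{ri}=\dot J_i^\sharp(\hat v_i-\alpha_i(x_i-\hat x_i))+J_i^\sharp(\hat a_i-\alpha_i(\dot x_i-\hat v_i))+\tfrac{d}{dt}[(I-J_i^\sharp J_i)\varphi_i],$$ $\hat s_i=\dot q_i-\dot{\hat q}_{ri}$, and let $\dot q_{ri},\ddot q_{ri},s_i$ be the same expressions with $(x_0,v_0,a_0)$ in place of $(\hat x_i,\hat v_i,\hat a_i)$. The DCEA consists of (E) together with $$u_i=Y_i(q_i,\dot q_i,\dot{\hat q}_{ri},\ddot{\hat q}_{ri})\hat\vartheta_i-J_i^T\mathcal K_{xi}J_i\hat s_i-\mathcal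 K_{si}\hat s_i-\mathcal K_{ri}\,\mathrm{sgn}(\hat s_i),\qquad \dot{\hat\vartheta}_i=-\mathcal T_iY_i^T(q_i,\dot q_i,\dot{\hat q}_{ri},\ddot{\hat q}_{ri})\hat s_i .$$ The mismatch term is $$\tilde f_i=\hat H_i(\ddot{\hat q}_{ri}-\ddot q_{ri})+\hat C_i(\dot{\hat q}_{ri}-\dot q_{ri})-J_i^T\mathcal K_{xi}J_i(\hat s_i-s_i)-\mathcal K_{si}(\hat s_i-s_i)-\mathcal K_{ri}[\mathrm{sgn}(\hat s_i)-\mathrm{sgn}(s_i)] .$$ Solutions of the discontinuous systems are Filippov solutions. Let $t_{f\max}=\max(t_{f1},t_{f2},t_{f3})$ with $$t_{f1}=t_0+\frac{\max_i\|\hat x_i(t_0)-x_0(t_0)\|_\infty}{\beta_1-\sup_{\mathcal Q}\|v_0\|_\infty},\quad t_{f2}=t_0+\frac{\max_i\|\hat v_i(t_0)-v_0(t_0)\|_\infty}{\beta_2-\sup_{\mathcal Q}\|a_0\|_\infty},\quad t_{f3}=t_0+\frac{\max_i\|\hat a_i(t_0)-a_0(t_0)\|_\infty}{\beta_3-\sup_{\mathcal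 Q}\|\dot a_0\|_\infty}.$$ **Theorem 1.** Under A1 and A2: 1. Every solution of (E) on $[t_0,\infty)$ satisfies $\zeta_i(t)=\zeta_0(t)$ for all $i$ and all $t\ge t_{f\max}$. In particular there is $t_f\in(t_0,\infty)$, with $t_f\le t_{f\max}$ whenever $t_{f\max}>t_0$, such that $\zeta_i(t)=\zeta_0(t)$ and $\tilde f_i(t)=0$ for all $t\ge t_f$ and all $i$, whatever the values of $q_i,\dot q_i,\hat\vartheta_i$. 2. For every $R$ there is $B$ such that every solution of the closed loop on an interval $[t_0,T)$, $t_0<T\le\infty$, whose initial values $q_i(t_0),\dot q_i(t_0),\hat\vartheta_i(t_0),\zeta_i(t_0)$ are bounded by $R$, has a settling time $t_f$ as in part 1 (for $t\in[t_0,T)$) with $\|q_i(t)\|,\|\dot q_i(t)\|,\|s_i(t)\|\le B$ for all $i$ and all $t\in[t_0,T)\cap[t_0,t_f)$. -/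

import Mathlib

open MeasureTheory Matrix

namespace MHM

noncomputable section

/-! ### Filippov solutions -/

/-- Filippov's regularization of the vector field `f` at `(t, x)`: the intersection, over all
radii `δ > 0` and all Lebesgue-null sets `N`, of the closed convex hulls of `f (t, B(x, δ) \ N)`. -/
def filippov {E : Type*} [NormedAddCommGroup E] [NormedSpace ℝ E] [MeasureSpace E]
    (f : ℝ → E → E) (t : ℝ) (x : E) : Set E :=
  ⋂ (δ : ℝ) (_ : 0 < δ) (N : Set E) (_ : (volume : Measure E) N = 0),
    closedConvexHull ℝ (f t '' (Metric.ball x δ \ N))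

/-- The time interval `[t₀, T)`, where `T` may be `∞`. -/
def timeInterval (t₀ : ℝ) (T : EReal) : Set ℝ := {t | t₀ ≤ t ∧ (t : EReal) < T}

/-- `z` is a Filippov solution of `z' = f (t, z)` on `[t₀, T)`: it is absolutely continuous on
the compact subintervals, and `z' (t)` exists and lies in Filippov's regularization for almost
every `t`. -/
def IsFilippovSolution {E : Type*} [NormedAddCommGroup E] [NormedSpace ℝ E] [MeasureSpace E]
    (f : ℝ → E → E) (t₀ : ℝ) (T : EReal) (z : ℝ → E) : Prop :=
  (∀ t ∈ timeInterval t₀ T, AbsolutelyContinuousOnInterval z t₀ t) ∧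
    ∀ᵐ t ∂(volume : Measure ℝ), t ∈ timeInterval t₀ T →
      ∃ w ∈ filippov f t (z t), HasDerivAt z w t

/-! ### The interaction network and the leader -/

/-- A weighted digraph on the nodes `Fin n`, with the pinning weights of the leader.
Node `i` receives information from node `j` iff `0 < ε i j`, and from the leader iff `0 < b i`. -/
structure Network (n : ℕ) where
  ε : Matrix (Fin n) (Fin n) ℝ
  b : Fin n → ℝ
  ε_nonneg : ∀ i j, 0 ≤ ε i j
  ε_diag : ∀ i, ε i i = 0
  b_nonneg : ∀ i, 0 ≤ b i

/-- The leader has a directed path to every node. -/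
def Network.LeaderReachesAll {n : ℕ} (N : Network n) : Prop :=
  ∀ i, ∃ k, 0 < N.b k ∧ Relation.ReflTransGen (fun j l => 0 < N.ε l j) k i

/-- Position, velocity, acceleration and derivative of the acceleration of the leader. -/
structure Leader (m : ℕ) where
  x₀ : ℝ → Fin m → ℝ
  v₀ : ℝ → Fin m → ℝ
  a₀ : ℝ → Fin m → ℝ
  j₀ : ℝ → Fin m → ℝ

/-- The stacked vectors `col (x, v, a)`; the norm of `Fin m → ℝ` is the `∞`-norm. -/
abbrev Triple (m : ℕ) : Type := Fin 3 → Fin m → ℝ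

/-- `col (x₀, v₀, a₀)` at time `t`. -/
def Leader.state {m : ℕ} (L : Leader m) (t : ℝ) : Triple m := ![L.x₀ t, L.v₀ t, L.a₀ t]

/-- `col (v₀, a₀, a₀')` at time `t`. -/
def Leader.rate {m : ℕ} (L : Leader m) (t : ℝ) : Triple m := ![L.v₀ t, L.a₀ t, L.j₀ t]

/-- `x₀' = v₀`, `v₀' = a₀`, and `j₀` is the derivative of `a₀`, on `[t₀, ∞)`. -/
def Leader.IsTrajectory {m : ℕ} (L : Leader m) (t₀ : ℝ) : Prop :=
  ∀ t, t₀ ≤ t → HasDerivWithinAt L.state (L.rate t) (Set.Ici t₀) t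

/-- `sup_{t ≥ t₀}` of the `∞`-norm of the `k`-th block of `col (v₀, a₀, a₀')`. -/
def Leader.supRate {m : ℕ} (L : Leader m) (t₀ : ℝ) (k : Fin 3) : ℝ :=
  ⨆ t : Set.Ici t₀, ‖L.rate t k‖

/-- `‖v₀‖_∞ < β₁`, `‖a₀‖_∞ < β₂`, `‖a₀'‖_∞ < β₃`, the norms being suprema over `[t₀, ∞)`. -/
def Leader.RateBound {m : ℕ} (L : Leader m) (t₀ : ℝ) (β : Fin 3 → ℝ) : Prop :=
  ∀ k, BddAbove (Set.range fun t : Set.Ici t₀ => ‖L.rate t k‖) ∧ L.supRate t₀ k < β k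

/-! ### The distributed sliding-mode estimator -/

/-- The right-hand side of the estimator. Since `ε i j = 0` when `j` is not a neighbour of `i`,
the sum over the neighbours is written over all nodes. -/
def estimatorField {n m : ℕ} (N : Network n) (L : Leader m) (β : Fin 3 → ℝ)
    (t : ℝ) (ζ : Fin n → Triple m) : Fin n → Triple m :=
  fun i k c => -(β k * Real.sign
    (∑ j, N.ε i j * (ζ i k c - ζ j k c) + N.b i * (ζ i k c - L.state t k c)))

/-- The bound `t₀ + max_i ‖ζ_i(t₀) - col(x₀, v₀, a₀)(t₀)‖_∞ / (β - sup ‖·‖_∞)` for the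
`k`-th block. -/
def blockSettlingBound {n m : ℕ} (L : Leader m) (β : Fin 3 → ℝ) (t₀ : ℝ)
    (ζ₀ : Fin n → Triple m) (k : Fin 3) : ℝ :=
  t₀ + (⨆ i, ‖ζ₀ i k - L.state t₀ k‖) / (β k - L.supRate t₀ k)

/-- The maximum of the three block bounds. -/
def settlingBound {n m : ℕ} (L : Leader m) (β : Fin 3 → ℝ) (t₀ : ℝ)
    (ζ₀ : Fin n → Triple m) : ℝ :=
  max (blockSettlingBound L β t₀ ζ₀ 0)
    (max (blockSettlingBound L β t₀ ζ₀ 1) (blockSettlingBound L β t₀ ζ₀ 2))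

/-! ### Manipulators -/

/-- The directional derivative of a matrix-valued map, entry by entry. -/
def matDeriv {p a b : ℕ} (A : (Fin p → ℝ) → Matrix (Fin a) (Fin b) ℝ) (q v : Fin p → ℝ) :
    Matrix (Fin a) (Fin b) ℝ :=
  Matrix.of fun i j => fderiv ℝ (fun q' => A q' i j) q v

/-- `Aᵀ (A Aᵀ)⁻¹`: the pseudoinverse of a matrix of full row rank; it is the
inverse of an invertible square matrix, see `pinv_eq_inv`. -/
def pinv {m p : ℕ} (A : Matrix (Fin m) (Fin p) ℝ) : Matrix (Fin p) (Fin m) ℝ :=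
  Aᵀ * (A * Aᵀ)⁻¹

theorem pinv_eq_inv {m : ℕ} (A : Matrix (Fin m) (Fin m) ℝ) (hA : IsUnit A.det) :
    pinv A = A⁻¹ := by
  have hT : IsUnit Aᵀ.det := by rwa [Matrix.det_transpose]
  rw [pinv, Matrix.mul_inv_rev, ← Matrix.mul_assoc, Matrix.mul_nonsing_inv _ hT, Matrix.one_mul]

/-- The componentwise signum, with `sgn 0 = 0`. -/
def sgn {k : ℕ} (w : Fin k → ℝ) : Fin k → ℝ := fun a => Real.sign (w a)

/-- The data of a manipulator with `p` joints, task-space dimension `m` and `r` dynamic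
parameters. `H`, `C`, `g`, `d` are the inertia matrix, the centripetal-Coriolis matrix, the gravity
vector and the disturbance, `ψ` is the forward kinematics, `Y` is the regressor `Y (q, q', y, x)`,
`ϑ` is the true parameter vector. `Hhat θ`, `Chat θ`, `ghat θ` are the estimates of
`H`, `C`, `g` made from the parameter estimate `θ`. `D` is the set of possible (singularity-free)
joint configurations. -/
structure Manipulator (m p r : ℕ) where
  H : (Fin p → ℝ) → Matrix (Fin p) (Fin p) ℝ
  C : (Fin p → ℝ) → (Fin p → ℝ) → Matrix (Fin p) (Fin p) ℝ
  g : (Fin p → ℝ) → Fin p → ℝ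
  d : ℝ → Fin p → ℝ
  ψ : (Fin p → ℝ) → Fin m → ℝ
  Y : (Fin p → ℝ) → (Fin p → ℝ) → (Fin p → ℝ) → (Fin p → ℝ) → Matrix (Fin p) (Fin r) ℝ
  ϑ : Fin r → ℝ
  Hhat : (Fin r → ℝ) → (Fin p → ℝ) → Matrix (Fin p) (Fin p) ℝ
  Chat : (Fin r → ℝ) → (Fin p → ℝ) → (Fin p → ℝ) → Matrix (Fin p) (Fin p) ℝ
  ghat : (Fin r → ℝ) → (Fin p → ℝ) → Fin p → ℝ
  D : Set (Fin p → ℝ)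

/-- The Jacobian matrix `∂ψ/∂q`. -/
def Manipulator.J {m p r : ℕ} (M : Manipulator m p r) (q : Fin p → ℝ) :
    Matrix (Fin m) (Fin p) ℝ :=
  Matrix.of fun a b => fderiv ℝ M.ψ q (Pi.single b 1) a

/-- `J^♯ (q)`. -/
def Manipulator.Jsharp {m p r : ℕ} (M : Manipulator m p r) (q : Fin p → ℝ) :
    Matrix (Fin p) (Fin m) ℝ :=
  pinv (M.J q)

/-- The standing properties of a manipulator. Matrix bounds are stated entry by entry, which is
the same as a bound of any matrix norm. -/
structure Manipulator.IsRegular {m p r : ℕ} (M : Manipulator m p r) (t₀ : ℝ) : Prop where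
  H_smooth : ∀ a b, ContDiff ℝ 1 fun q => M.H q a b
  C_cont : ∀ a b, Continuous fun x : (Fin p → ℝ) × (Fin p → ℝ) => M.C x.1 x.2 a b
  g_cont : Continuous M.g
  Y_cont : ∀ a b, Continuous
    fun x : (Fin p → ℝ) × (Fin p → ℝ) × (Fin p → ℝ) × (Fin p → ℝ) =>
      M.Y x.1 x.2.1 x.2.2.1 x.2.2.2 a b
  ψ_smooth : ContDiff ℝ 2 M.ψ
  H_posDef : ∀ q, (M.H q).PosDef
  skew : ∀ q v, (matDeriv M.H q v - (2 : ℝ) • M.C q v)ᵀ = -(matDeriv M.H q v - (2 : ℝ) • M.C q v)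
  H_bdd : ∃ c, ∀ q a b, |M.H q a b| ≤ c
  g_bdd : ∃ c, ∀ q, ‖M.g q‖ ≤ c
  d_bdd : ∃ c, ∀ t, t₀ ≤ t → ‖M.d t‖ ≤ c
  C_bdd : ∃ c, 0 < c ∧ ∀ q v a b, |M.C q v a b| ≤ c * ‖v‖
  regressor : ∀ q v y x, M.H q *ᵥ x + M.C q v *ᵥ y + M.g q = M.Y q v y x *ᵥ M.ϑ
  regressor_hat : ∀ θ q v y x,
    M.Hhat θ q *ᵥ x + M.Chat θ q v *ᵥ y + M.ghat θ q = M.Y q v y x *ᵥ θ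
  J_bdd : ∃ c, ∀ q ∈ M.D, ∀ a b, |M.J q a b| ≤ c
  Jsharp_bdd : ∃ c, ∀ q ∈ M.D, ∀ a b, |M.Jsharp q a b| ≤ c
  J_rank : ∀ q ∈ M.D, (M.J q).rank = m

/-! ### The control law -/

/-- The design data of a local controller: the constant `α`, the auxiliary vector
`φ (t, q)` of the subtask, the gain matrices, and the diagonal `τ` of the adaptation gain. -/
structure Controller (m p r : ℕ) where
  α : ℝ
  φ : ℝ → (Fin p → ℝ) → Fin p → ℝ
  Kx : Matrix (Fin m) (Fin m) ℝ
  Ks : Matrix (Fin p) (Fin p) ℝ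
  Kr : Matrix (Fin p) (Fin p) ℝ
  τ : Fin r → ℝ

/-- The standing properties of the design data: positive gains, and an auxiliary vector that is
continuously differentiable and grows at most linearly in `q`, uniformly on bounded time
intervals. -/
structure Controller.IsAdmissible {m p r : ℕ} (G : Controller m p r) (t₀ : ℝ) : Prop where
  α_pos : 0 < G.α
  Kx_posDef : G.Kx.PosDef
  Ks_posDef : G.Ks.PosDef
  Kr_posDef : G.Kr.PosDef
  τ_pos : ∀ a, 0 < G.τ a
  φ_smooth : ContDiff ℝ 1 fun x : ℝ × (Fin p → ℝ) => G.φ x.1 x.2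
  φ_growth : ∀ T, ∃ c, ∀ t, t₀ ≤ t → t ≤ T → ∀ q, ‖G.φ t q‖ ≤ c * (1 + ‖q‖)

section Local

variable {m p r : ℕ} (M : Manipulator m p r) (G : Controller m p r)

/-- The subtask part `(I - J^♯ J) φ`. -/
def nullTerm (t : ℝ) (q : Fin p → ℝ) : Fin p → ℝ :=
  (1 - M.Jsharp q * M.J q) *ᵥ G.φ t q

/-- The total time derivative of `nullTerm` along a motion with position `q` and velocity `v`. -/
def nullTermDeriv (t : ℝ) (q v : Fin p → ℝ) : Fin p → ℝ :=
  fderiv ℝ (fun x : ℝ × (Fin p → ℝ) => nullTerm M G x.1 x.2) (t, q) (1, v)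

/-- The joint-space auxiliary velocity formed with the reference triple `χ`: the estimate
`ζ_i` gives the hatted variable, the leader's state gives the normal one. -/
def refVel (t : ℝ) (q : Fin p → ℝ) (χ : Triple m) : Fin p → ℝ :=
  M.Jsharp q *ᵥ (χ 1 - G.α • (M.ψ q - χ 0)) + nullTerm M G t q

/-- The joint-space auxiliary acceleration formed with the reference triple `χ`
(task-space velocity `x' = J q'`). -/
def refAcc (t : ℝ) (q v : Fin p → ℝ) (χ : Triple m) : Fin p → ℝ :=
  matDeriv M.Jsharp q v *ᵥ (χ 1 - G.α • (M.ψ q - χ 0))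
    + M.Jsharp q *ᵥ (χ 2 - G.α • (M.J q *ᵥ v - χ 1))
    + nullTermDeriv M G t q v

/-- `q' - refVel`: the variable `ŝ_i` for `χ = ζ_i`, and `s_i` for the leader's state. -/
def slide (t : ℝ) (q v : Fin p → ℝ) (χ : Triple m) : Fin p → ℝ :=
  v - refVel M G t q χ

/-- The regressor `Y (q, q', q̂_r', q̂_r'')`. -/
def regressorHat (t : ℝ) (q v : Fin p → ℝ) (ζ : Triple m) : Matrix (Fin p) (Fin r) ℝ :=
  M.Y q v (refVel M G t q ζ) (refAcc M G t q v ζ)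

/-- The control law `u_i`. -/
def control (t : ℝ) (q v : Fin p → ℝ) (θ : Fin r → ℝ) (ζ : Triple m) : Fin p → ℝ :=
  regressorHat M G t q v ζ *ᵥ θ
    - ((M.J q)ᵀ * G.Kx * M.J q) *ᵥ slide M G t q v ζ
    - G.Ks *ᵥ slide M G t q v ζ
    - G.Kr *ᵥ sgn (slide M G t q v ζ)

/-- The right-hand side, for the state `(q, q', θ)`, of the manipulator dynamics solved for `q''`
under the control law, together with the parameter adaptation law. -/
def localField (t : ℝ) (s : (Fin p → ℝ) × (Fin p → ℝ) × (Fin r → ℝ)) (ζ : Triple m) :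
    (Fin p → ℝ) × (Fin p → ℝ) × (Fin r → ℝ) :=
  (s.2.1,
    (M.H s.1)⁻¹ *ᵥ
      (control M G t s.1 s.2.1 s.2.2 ζ - M.C s.1 s.2.1 *ᵥ s.2.1 - M.g s.1 - M.d t),
    -((Matrix.diagonal G.τ * (regressorHat M G t s.1 s.2.1 ζ)ᵀ) *ᵥ slide M G t s.1 s.2.1 ζ))

/-- The mismatch term: with `χ` the leader's state and `ζ` the estimate,
`Ĥ Δq_r'' + Ĉ Δq_r' - Jᵀ Kx J Δs - Ks Δs - Kr [sgn ŝ - sgn s]`, where `Δ` is the hatted variable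
minus the normal one. -/
def mismatch (L : Leader m) (t : ℝ) (q v : Fin p → ℝ) (θ : Fin r → ℝ) (ζ : Triple m) :
    Fin p → ℝ :=
  M.Hhat θ q *ᵥ (refAcc M G t q v ζ - refAcc M G t q v (L.state t))
    + M.Chat θ q v *ᵥ (refVel M G t q ζ - refVel M G t q (L.state t))
    - ((M.J q)ᵀ * G.Kx * M.J q) *ᵥ (slide M G t q v ζ - slide M G t q v (L.state t))
    - G.Ks *ᵥ (slide M G t q v ζ - slide M G t q v (L.state t))
    - G.Kr *ᵥ (sgn (slide M G t q v ζ) - sgn (slide M G t q v (L.state t)))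

end Local

/-! ### The closed loop -/

/-- The state of the closed loop: `(q_i, q_i', θ_i)` for every node, and all the `ζ_i`. -/
abbrev LoopState (n m : ℕ) (p r : Fin n → ℕ) : Type :=
  ((i : Fin n) → (Fin (p i) → ℝ) × (Fin (p i) → ℝ) × (Fin (r i) → ℝ)) × (Fin n → Triple m)

/-- The right-hand side of the closed loop of all manipulators and estimators. -/
def loopField {n m : ℕ} {p r : Fin n → ℕ} (M : (i : Fin n) → Manipulator m (p i) (r i))
    (G : (i : Fin n) → Controller m (p i) (r i)) (N : Network n) (L : Leader m) (β : Fin 3 → ℝ)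
    (t : ℝ) (z : LoopState n m p r) : LoopState n m p r :=
  (fun i => localField (M i) (G i) t (z.1 i) (z.2 i), estimatorField N L β t z.2)

/-- `z` is a motion of the closed loop on `[t₀, T)`: a Filippov solution along which the
joint positions stay in the sets of possible configurations. -/
def IsLoopSolution {n m : ℕ} {p r : Fin n → ℕ} (M : (i : Fin n) → Manipulator m (p i) (r i))
    (G : (i : Fin n) → Controller m (p i) (r i)) (N : Network n) (L : Leader m) (β : Fin 3 → ℝ)
    (t₀ : ℝ) (T : EReal) (z : ℝ → LoopState n m p r) : Prop :=
  IsFilippovSolution (loopField M G N L β) t₀ T z ∧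
    ∀ t ∈ timeInterval t₀ T, ∀ i, ((z t).1 i).1 ∈ (M i).D

end

end MHM

namespace MHM

open Set Filter Topology

/-! ### Absolutely continuous curves -/

/-! Settling. Each block k of the estimator decouples. Let W be the largest absolute component of
the errors of block k over all nodes. Where W is positive, a directed path from the leader yields a
maximizing node whose signum argument is strictly nonzero with the sign of its error: going back
along the path, either some edge leads to a smaller signed error, or the pinned node is itself a
maximizer. Near that state the signum is constant, so Filippov's set prescribes the rate exactly
there. The signed error of this node touches W from below, hence W' ≤ -(β k - sup rate) wherever W'
exists (`hasDerivAt_blockError_le`). Absolute continuity turns this into extinction by the stated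
time (`IsSlidingCurve.eq_state`), and the mismatch then vanishes because its two reference triples
coincide.

No escape. The settling time is bounded uniformly for bounded initial data, so it is enough to bound
the motion on a fixed finite time interval. There the estimates and their velocities are bounded.
Let E be half of ŝᵀHŝ plus half the weighted squared parameter error. The adaptation law cancels the
parameter error, and skew symmetry cancels the Coriolis term. Since the estimates need not satisfy
x̂' = v̂, v̂' = â, a bounded extra term remains in ŝ'. With the disturbance and the switching term
it gives E' ≤ c‖ŝ‖ - μ‖ŝ‖² (`energy_deriv_le`, `exists_energy_dissipation`).

Positions are measured by P = √(1 + |q|² + |ψ(q)|²). As q' = ŝ plus a reference velocity of linear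
growth in P, P' ≤ l(‖ŝ‖ + 3kP). The quadratic damping absorbs the terms linear in ŝ, so (P + E)' ≤
K(P + E) (`exists_lyapunov_growth`), and Grönwall bounds P + E. Boundedness of q makes H uniformly
positive on the relevant compact ball, which bounds ŝ, then q' and s (`exists_agent_bound`).

Both halves need only one-sided bounds of linear functionals on Filippov's set (`filippov_le`),
never a description of that set. -/

theorem _root_.AbsolutelyContinuousOnInterval.of_dist_le {X Y : Type*} [PseudoMetricSpace X]
    [PseudoMetricSpace Y] {f : ℝ → X} {g : ℝ → Y} {a b K : ℝ}
    (hf : AbsolutelyContinuousOnInterval f a b)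
    (h : ∀ s ∈ uIcc a b, ∀ t ∈ uIcc a b, dist (g s) (g t) ≤ K * dist (f s) (f t)) :
    AbsolutelyContinuousOnInterval g a b := by
  unfold AbsolutelyContinuousOnInterval at hf ⊢
  refine squeeze_zero' (Eventually.of_forall fun _ => Finset.sum_nonneg fun _ _ => dist_nonneg) ?_
    (by simpa using hf.const_mul K)
  rw [eventually_inf_principal]
  refine Eventually.of_forall fun E hE => ?_
  rw [Finset.mul_sum]
  exact Finset.sum_le_sum fun i hi => h _ (hE.1 i hi).1 _ (hE.1 i hi).2

theorem _root_.LipschitzOnWith.comp_absolutelyContinuousOnInterval {X Y : Type*}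
    [PseudoMetricSpace X] [PseudoMetricSpace Y] {F : X → Y} {f : ℝ → X} {a b : ℝ} {K : NNReal}
    {S : Set X} (hF : LipschitzOnWith K F S) (hS : ∀ t ∈ uIcc a b, f t ∈ S)
    (hf : AbsolutelyContinuousOnInterval f a b) :
    AbsolutelyContinuousOnInterval (fun t => F (f t)) a b :=
  hf.of_dist_le fun s hs t ht => hF.dist_le_mul _ (hS s hs) _ (hS t ht)

theorem _root_.AbsolutelyContinuousOnInterval.prodMk {X Y : Type*} [PseudoMetricSpace X]
    [PseudoMetricSpace Y] {f : ℝ → X} {g : ℝ → Y} {a b : ℝ}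
    (hf : AbsolutelyContinuousOnInterval f a b) (hg : AbsolutelyContinuousOnInterval g a b) :
    AbsolutelyContinuousOnInterval (fun t => (f t, g t)) a b := by
  refine squeeze_zero (fun _ => Finset.sum_nonneg fun _ _ => dist_nonneg) (fun E => ?_)
    (by simpa using Tendsto.add hf hg)
  rw [← Finset.sum_add_distrib]
  exact Finset.sum_le_sum fun i _ =>
    max_le (le_add_of_nonneg_right dist_nonneg) (le_add_of_nonneg_left dist_nonneg)

theorem absolutelyContinuousOnInterval_id (a b : ℝ) :
    AbsolutelyContinuousOnInterval (fun t : ℝ => t) a b :=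
  (LipschitzWith.id.lipschitzOnWith (s := uIcc a b)).absolutelyContinuousOnInterval

/-- A locally Lipschitz map is Lipschitz on the compact image of the curve. Smoothness is asked only
at points of the curve, because the pseudoinverse is known to be smooth only at configurations in
`D`. -/
theorem _root_.AbsolutelyContinuousOnInterval.comp_contDiffAt {E F : Type*}
    [NormedAddCommGroup E] [NormedSpace ℝ E] [NormedAddCommGroup F] [NormedSpace ℝ F]
    {Φ : E → F} {f : ℝ → E} {a b : ℝ} (hf : AbsolutelyContinuousOnInterval f a b)
    (hΦ : ∀ t ∈ uIcc a b, ContDiffAt ℝ 1 Φ (f t)) :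
    AbsolutelyContinuousOnInterval (fun t => Φ (f t)) a b := by
  obtain ⟨K, hK⟩ := LocallyLipschitzOn.exists_lipschitzOnWith_of_compact (f := Φ)
    (isCompact_uIcc.image_of_continuousOn hf.continuousOn) (by
      rintro _ ⟨t, ht, rfl⟩
      obtain ⟨K, S, hS, hK⟩ := (hΦ t ht).exists_lipschitzOnWith
      exact ⟨K, S, mem_nhdsWithin_of_mem_nhds hS, hK⟩)
  exact hK.comp_absolutelyContinuousOnInterval (fun t ht => mem_image_of_mem f ht) hf

/-- The fundamental theorem of calculus for absolutely continuous functions. Existence of the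
derivative is automatic almost everywhere, so a nonsmooth function such as a maximum may be
estimated only where it happens to be differentiable. -/
theorem _root_.AbsolutelyContinuousOnInterval.sub_le_of_deriv_le {f : ℝ → ℝ} {a b C : ℝ}
    (hab : a ≤ b) (hf : AbsolutelyContinuousOnInterval f a b)
    (h : ∀ᵐ t ∂(volume : Measure ℝ), t ∈ Ioo a b → ∀ D, HasDerivAt f D t → D ≤ C) :
    f b - f a ≤ C * (b - a) := by
  rw [← hf.integral_deriv_eq_sub]
  have h1 : ∫ t in a..b, deriv f t ≤ ∫ _ in a..b, C := by
    refine intervalIntegral.integral_mono_ae_restrict hab hf.intervalIntegrable_deriv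
      intervalIntegrable_const ?_
    rw [← restrict_Ioo_eq_restrict_Icc]
    refine (ae_restrict_iff' measurableSet_Ioo).2 ?_
    filter_upwards [h, hf.ae_differentiableAt] with t ht hd hm
    exact ht hm _ (hd (Ioo_subset_Icc_self.trans Icc_subset_uIcc hm)).hasDerivAt
  simpa [mul_comm] using h1

/-- Grönwall: the integrating factor exp(-Kt) makes f nonincreasing. -/
theorem _root_.AbsolutelyContinuousOnInterval.le_mul_exp {f : ℝ → ℝ} {a b K : ℝ}
    (hab : a ≤ b) (hf : AbsolutelyContinuousOnInterval f a b)
    (h : ∀ᵐ t ∂(volume : Measure ℝ), t ∈ Ioo a b → ∀ D, HasDerivAt f D t → D ≤ K * f t) :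
    f b ≤ f a * Real.exp (K * (b - a)) := by
  have hexp (t : ℝ) : HasDerivAt (fun t => Real.exp (-(K * t))) (Real.exp (-(K * t)) * (-K)) t := by
    simpa using (((hasDerivAt_id t).const_mul K).neg).exp
  have hg : AbsolutelyContinuousOnInterval (fun t => f t * Real.exp (-(K * t))) a b :=
    hf.fun_mul (ContDiffOn.absolutelyContinuousOnInterval
      (ContDiff.contDiffOn (by fun_prop)))
  have := hg.sub_le_of_deriv_le (C := 0) hab (by
    filter_upwards [h, hf.ae_differentiableAt] with t ht hd hm D hD
    have hf' := (hd (Ioo_subset_Icc_self.trans Icc_subset_uIcc hm)).hasDerivAt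
    have h1 := ht hm _ hf'
    have h2 := hD.unique (hf'.mul (hexp t))
    have h3 := Real.exp_pos (-(K * t))
    have : D = (deriv f t - K * f t) * Real.exp (-(K * t)) := by rw [h2]; ring
    rw [this]
    exact mul_nonpos_of_nonpos_of_nonneg (by linarith) h3.le)
  have h4 : f b * Real.exp (-(K * b)) ≤ f a * Real.exp (-(K * a)) := by linarith
  have h5 := mul_le_mul_of_nonneg_right h4 (Real.exp_pos (K * b)).le
  rw [mul_assoc, mul_assoc, ← Real.exp_add, ← Real.exp_add] at h5
  rw [neg_add_cancel, Real.exp_zero, mul_one] at h5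
  rwa [show -(K * a) + K * b = K * (b - a) by ring] at h5

/-! ### Filippov's regularization -/

section Filippov

variable {E : Type*} [NormedAddCommGroup E] [NormedSpace ℝ E] [MeasureSpace E]
  {f : ℝ → E → E} {t : ℝ} {z w : E}

/-- Closed half-spaces are closed and convex, so they contain the closed convex hull once they
contain the values. Continuity of `Ψ` replaces its nearby values by the one at z, up to η. -/
theorem filippov_le (hw : w ∈ filippov f t z) (l : E →L[ℝ] ℝ) {Ψ : E → ℝ}
    (hΨ : ContinuousAt Ψ z) (h : ∀ᶠ z' in 𝓝 z, l (f t z') ≤ Ψ z') : l w ≤ Ψ z := by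
  refine le_of_forall_pos_le_add fun η hη => ?_
  obtain ⟨δ, hδ, hb⟩ := Metric.eventually_nhds_iff_ball.1
    (h.and (hΨ.eventually_lt_const (lt_add_of_pos_right (Ψ z) hη)))
  simp only [filippov, mem_iInter] at hw
  -- The bound holds at every nearby point, so the empty null set suffices.
  have := hw δ hδ ∅ (by simp)
  have hsub : closedConvexHull ℝ (f t '' (Metric.ball z δ \ ∅)) ⊆ {w | l w ≤ Ψ z + η} := by
    refine closedConvexHull_min ?_ (convex_halfSpace_le l.toLinearMap.isLinear _)
      (isClosed_le l.continuous continuous_const)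
    rintro _ ⟨z', hz', rfl⟩
    have := hb z' hz'.1
    exact this.1.trans this.2.le
  exact hsub this

theorem filippov_eq (hw : w ∈ filippov f t z) (l : E →L[ℝ] ℝ) {Ψ : E → ℝ}
    (hΨ : ContinuousAt Ψ z) (h : ∀ᶠ z' in 𝓝 z, l (f t z') = Ψ z') : l w = Ψ z := by
  refine le_antisymm (filippov_le hw l hΨ (h.mono fun _ h => h.le)) ?_
  have := filippov_le hw (-l) hΨ.neg (h.mono fun _ h => by simp [h])
  simpa using this

end Filippov

/-! ### The estimator settles in finite time -/

theorem timeInterval_mono {t₀ s t : ℝ} {T : EReal} (ht : t ∈ timeInterval t₀ T) (h₀ : t₀ ≤ s)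
    (hs : s ≤ t) : s ∈ timeInterval t₀ T :=
  ⟨h₀, (EReal.coe_le_coe_iff.2 hs).trans_lt ht.2⟩

theorem eq_of_hasDerivAt_of_touching {f g : ℝ → ℝ} {t D D' : ℝ} (hf : HasDerivAt f D t)
    (hg : HasDerivAt g D' t) (h : f t = g t) (hle : ∀ s, g s ≤ f s) : D = D' := by
  have hmin : IsLocalMin (fun s => f s - g s) t :=
    Eventually.of_forall fun s => by simp only [h, sub_self]; linarith [hle s]
  linarith [hmin.hasDerivAt_eq_zero (hf.sub hg)]

/-- At a positive maximum over the nodes, some maximizer is pulled down. -/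
theorem Network.exists_maximizer_pos {n : ℕ} {N : Network n} (hN : N.LeaderReachesAll)
    {u : Fin n → ℝ} {W : ℝ} (hW : 0 < W) (hu : ∀ j, u j ≤ W) {i : Fin n} (hi : u i = W) :
    ∃ j, u j = W ∧ 0 < ∑ l, N.ε j l * (u j - u l) + N.b j * u j := by
  obtain ⟨k, hk, hpath⟩ := hN i
  have hterm (j : Fin n) (hj : u j = W) (l : Fin n) : 0 ≤ N.ε j l * (u j - u l) :=
    mul_nonneg (N.ε_nonneg j l) (by linarith [hu l])
  -- Walk back from i towards the pinned node. A predecessor below W gives a strictly positive edge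
  -- term; a predecessor equal to W continues the walk; at the pinned node the leader's term is
  -- strictly positive.
  induction hpath with
  | refl =>
    exact ⟨k, hi, add_pos_of_nonneg_of_pos (Finset.sum_nonneg fun l _ => hterm k hi l)
      (mul_pos hk (hi ▸ hW))⟩
  | @tail x y _ hxy ih =>
    rcases (hu x).eq_or_lt with hx | hx
    · exact ih hx
    · refine ⟨y, hi, add_pos_of_pos_of_nonneg ?_ (mul_nonneg (N.b_nonneg y) (by linarith))⟩
      exact Finset.sum_pos' (fun l _ => hterm y hi l)
        ⟨x, Finset.mem_univ x, mul_pos hxy (by linarith)⟩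

section Leader

variable {m : ℕ} {L : Leader m} {t₀ : ℝ} {β : Fin 3 → ℝ}

theorem Leader.RateBound.norm_rate_le (h : L.RateBound t₀ β) {t : ℝ} (ht : t₀ ≤ t) (k : Fin 3) :
    ‖L.rate t k‖ ≤ L.supRate t₀ k :=
  le_ciSup (h k).1 (⟨t, ht⟩ : Ici t₀)

theorem Leader.RateBound.supRate_nonneg (h : L.RateBound t₀ β) (k : Fin 3) :
    0 ≤ L.supRate t₀ k :=
  (norm_nonneg _).trans (h.norm_rate_le le_rfl k)

theorem Leader.RateBound.pos (h : L.RateBound t₀ β) (k : Fin 3) : 0 < β k :=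
  (h.supRate_nonneg k).trans_lt (h k).2

theorem Leader.IsTrajectory.hasDerivAt (hL : L.IsTrajectory t₀) {t : ℝ} (ht : t₀ < t) :
    HasDerivAt L.state (L.rate t) t :=
  (hL t ht.le).hasDerivAt (Ici_mem_nhds ht)

/-- The bounded rates make the leader's state Lipschitz; continuity of the derivative of a₀ is not
required. -/
theorem Leader.IsTrajectory.absolutelyContinuous (hL : L.IsTrajectory t₀)
    (h : L.RateBound t₀ β) {t : ℝ} (ht : t₀ ≤ t) :
    AbsolutelyContinuousOnInterval L.state t₀ t := by
  have hC (s : ℝ) (hs : t₀ ≤ s) : ‖L.rate s‖ ≤ ∑ k, L.supRate t₀ k :=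
    (pi_norm_le_iff_of_nonneg (Finset.sum_nonneg fun k _ => h.supRate_nonneg k)).2 fun k =>
      (h.norm_rate_le hs k).trans
        (Finset.single_le_sum (fun k _ => h.supRate_nonneg k) (Finset.mem_univ k))
  refine LipschitzOnWith.absolutelyContinuousOnInterval
    (K := ⟨∑ k, L.supRate t₀ k, Finset.sum_nonneg fun k _ => h.supRate_nonneg k⟩) ?_
  rw [uIcc_of_le ht]
  exact (convex_Icc t₀ t).lipschitzOnWith_of_nnnorm_hasDerivWithin_le
    (fun s hs => (hL s hs.1).mono Icc_subset_Ici_self) (fun s hs => hC s hs.1)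

end Leader

/-- The argument of the signum in the estimator. -/
def disagreement {n m : ℕ} (N : Network n) (L : Leader m) (t : ℝ) (ζ : Fin n → Triple m)
    (i : Fin n) (k : Fin 3) (c : Fin m) : ℝ :=
  ∑ j, N.ε i j * (ζ i k c - ζ j k c) + N.b i * (ζ i k c - L.state t k c)

/-- The differential inclusion of the estimator away from the switching surfaces. -/
def IsSlidingCurve {n m : ℕ} (N : Network n) (L : Leader m) (β : Fin 3 → ℝ) (t₀ : ℝ) (T : EReal)
    (ζ : ℝ → Fin n → Triple m) : Prop :=
  (∀ t ∈ timeInterval t₀ T, AbsolutelyContinuousOnInterval ζ t₀ t) ∧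
    ∀ᵐ t ∂(volume : Measure ℝ), t ∈ timeInterval t₀ T → ∃ w, HasDerivAt ζ w t ∧ ∀ i k c,
      (0 < disagreement N L t (ζ t) i k c → w i k c = -β k) ∧
      (disagreement N L t (ζ t) i k c < 0 → w i k c = β k)

section Settling

variable {n m : ℕ} {N : Network n} {L : Leader m} {β : Fin 3 → ℝ} {t₀ : ℝ} {T : EReal}
  {ζ : ℝ → Fin n → Triple m}

theorem hasDerivAt_blockError_le (hL : L.IsTrajectory t₀) (hN : N.LeaderReachesAll)
    (hA : L.RateBound t₀ β) {t : ℝ} (ht : t₀ < t) {w : Fin n → Triple m}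
    (hw : HasDerivAt ζ w t) (hs : ∀ i k c,
      (0 < disagreement N L t (ζ t) i k c → w i k c = -β k) ∧
      (disagreement N L t (ζ t) i k c < 0 → w i k c = β k)) {k : Fin 3} {D : ℝ}
    (hW : 0 < ‖fun i => ζ t i k - L.state t k‖)
    (hD : HasDerivAt (fun t => ‖fun i => ζ t i k - L.state t k‖) D t) :
    D ≤ -(β k - L.supRate t₀ k) := by
  set W : ℝ → ℝ := fun t => ‖fun i => ζ t i k - L.state t k‖ with hWdef
  have hle (s : ℝ) (i : Fin n) (c : Fin m) : |ζ s i k c - L.state s k c| ≤ W s :=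
    (norm_le_pi_norm (ζ s i k - L.state s k) c).trans
      (norm_le_pi_norm (fun i => ζ s i k - L.state s k) i)
  obtain ⟨i, c, hic⟩ : ∃ i c, |ζ t i k c - L.state t k c| = W t := by
    by_contra! hne
    refine lt_irrefl (W t) ((pi_norm_lt_iff hW).2 fun i => (pi_norm_lt_iff hW).2 fun c => ?_)
    exact lt_of_le_of_ne (hle t i c) (hne i c)
  obtain ⟨σ, hσ, hσW⟩ : ∃ σ : ℝ, (σ = 1 ∨ σ = -1) ∧ σ * (ζ t i k c - L.state t k c) = W t := by
    rcases abs_choice (ζ t i k c - L.state t k c) with h | h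
    · exact ⟨1, Or.inl rfl, by linarith⟩
    · exact ⟨-1, Or.inr rfl, by linarith⟩
  have hσle (s : ℝ) (j : Fin n) : σ * (ζ s j k c - L.state s k c) ≤ W s := by
    have := abs_le.1 (hle s j c)
    rcases hσ with rfl | rfl <;> linarith
  obtain ⟨j, hj, hpos⟩ := N.exists_maximizer_pos hN hW (hσle t) hσW
  have hdis : σ * disagreement N L t (ζ t) j k c =
      ∑ l, N.ε j l * (σ * (ζ t j k c - L.state t k c) - σ * (ζ t l k c - L.state t k c)) +
        N.b j * (σ * (ζ t j k c - L.state t k c)) := by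
    rw [disagreement, mul_add, Finset.mul_sum]
    congr 1
    · exact Finset.sum_congr rfl fun l _ => by ring
    · ring
  rw [← hdis] at hpos
  have hwj : σ * w j k c = -β k := by
    rcases hσ with rfl | rfl
    · rw [one_mul] at hpos ⊢
      exact (hs j k c).1 hpos
    · rw [(hs j k c).2 (by linarith)]
      ring
  have hζ : HasDerivAt (fun s => ζ s j k c) (w j k c) t :=
    hasDerivAt_pi.1 (hasDerivAt_pi.1 (hasDerivAt_pi.1 hw j) k) c
  have hst : HasDerivAt (fun s => L.state s k c) (L.rate t k c) t :=
    hasDerivAt_pi.1 (hasDerivAt_pi.1 (hL.hasDerivAt ht) k) c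
  -- The signed error of the fixed node j and component c never exceeds W and equals it at t, so the
  -- two derivatives agree.
  have heq := eq_of_hasDerivAt_of_touching hD ((hζ.sub hst).const_mul σ) hj.symm
    (fun s => hσle s j)
  have hr := abs_le.1 ((norm_le_pi_norm (L.rate t k) c).trans (hA.norm_rate_le ht.le k))
  rw [heq]
  rcases hσ with rfl | rfl <;> linarith

theorem IsSlidingCurve.absolutelyContinuous_blockError (hζ : IsSlidingCurve N L β t₀ T ζ)
    (hL : L.IsTrajectory t₀) (hA : L.RateBound t₀ β) (k : Fin 3) {t : ℝ}
    (ht : t ∈ timeInterval t₀ T) :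
    AbsolutelyContinuousOnInterval (fun t => ‖fun i => ζ t i k - L.state t k‖) t₀ t := by
  have h := ((hζ.1 t ht).prodMk (hL.absolutelyContinuous hA ht.1)).comp_contDiffAt
    (Φ := fun z : (Fin n → Triple m) × Triple m => fun i => z.1 i k - z.2 k)
    (fun s _ => ContDiff.contDiffAt (by fun_prop))
  exact h.of_dist_le (K := 1) fun s _ u _ => by
    rw [one_mul, Real.dist_eq, dist_eq_norm]
    exact abs_norm_sub_norm_le _ _

theorem IsSlidingCurve.eq_state (hζ : IsSlidingCurve N L β t₀ T ζ) (hL : L.IsTrajectory t₀)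
    (hN : N.LeaderReachesAll) (hA : L.RateBound t₀ β) {t : ℝ} (ht : t ∈ timeInterval t₀ T)
    (hst : settlingBound L β t₀ (ζ t₀) ≤ t) (i : Fin n) : ζ t i = L.state t := by
  funext k
  set W : ℝ → ℝ := fun t => ‖fun i => ζ t i k - L.state t k‖ with hWdef
  have hAC := hζ.absolutelyContinuous_blockError hL hA k ht
  have hpos := sub_pos.2 (hA k).2
  have hder : ∀ᵐ s ∂(volume : Measure ℝ), s ∈ Ioo t₀ t → ∀ D, HasDerivAt W D s →
      0 < W s → D ≤ -(β k - L.supRate t₀ k) := by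
    filter_upwards [hζ.2] with s hs hm D hD hW
    obtain ⟨w, hw, hsgn⟩ := hs (timeInterval_mono ht hm.1.le hm.2.le)
    exact hasDerivAt_blockError_le hL hN hA hm.1 hw hsgn hW hD
  have hanti (s : ℝ) (hs : s ∈ Icc t₀ t) : W t ≤ W s := by
    have := (hAC.mono (c := s) (d := t) (by
      rw [uIcc_of_le hs.2, uIcc_of_le ht.1]; exact Icc_subset_Icc_left hs.1)).sub_le_of_deriv_le
      (C := 0) hs.2 (by
        filter_upwards [hder] with u hu hm D hD
        rcases (norm_nonneg (fun i => ζ u i k - L.state u k)).eq_or_lt with h0 | h0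
        -- The decay estimate needs W > 0; where W vanishes it attains its global minimum, and its
        -- derivative is zero.
        · have hmin : IsLocalMin W u := Eventually.of_forall fun v => by
            rw [hWdef]; dsimp only; rw [← h0]; exact norm_nonneg _
          exact (hmin.hasDerivAt_eq_zero hD).le
        · linarith [hu ⟨hs.1.trans_lt hm.1, hm.2⟩ D hD h0])
    linarith
  have hzero : W t = 0 := by
    by_contra hne
    have hWt : 0 < W t := lt_of_le_of_ne (norm_nonneg _) (Ne.symm hne)
    -- By monotonicity W stays positive on the whole of [t₀, t], so the strict decay applies
    -- throughout and would exhaust the initial error before t.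
    have h1 := hAC.sub_le_of_deriv_le (C := -(β k - L.supRate t₀ k)) ht.1 (by
      filter_upwards [hder] with u hu hm D hD
      exact hu hm D hD (hWt.trans_le (hanti u ⟨hm.1.le, hm.2.le⟩)))
    have h2 : blockSettlingBound L β t₀ (ζ t₀) k ≤ t := by
      refine le_trans ?_ hst
      rw [settlingBound]
      fin_cases k <;> simp
    have h3 : W t₀ ≤ ⨆ i, ‖ζ t₀ i k - L.state t₀ k‖ :=
      (pi_norm_le_iff_of_nonneg (Real.iSup_nonneg fun i => norm_nonneg _)).2 fun i =>
        le_ciSup (f := fun i => ‖ζ t₀ i k - L.state t₀ k‖) (finite_range _).bddAbove i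
    have h4 : (⨆ i, ‖ζ t₀ i k - L.state t₀ k‖) / (β k - L.supRate t₀ k) ≤ t - t₀ := by
      rw [blockSettlingBound] at h2
      linarith
    rw [div_le_iff₀ hpos] at h4
    linarith
  exact sub_eq_zero.1 (norm_le_zero_iff.1
    ((norm_le_pi_norm (fun i => ζ t i k - L.state t k) i).trans hzero.le))

end Settling

/-! ### The estimator as a factor of a larger Filippov system -/

theorem disagreement_continuous {n m : ℕ} (N : Network n) (L : Leader m) (t : ℝ) (i : Fin n)
    (k : Fin 3) (c : Fin m) : Continuous fun ζ => disagreement N L t ζ i k c := by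
  unfold disagreement
  fun_prop

theorem estimatorField_apply {n m : ℕ} (N : Network n) (L : Leader m) (β : Fin 3 → ℝ) (t : ℝ)
    (ζ : Fin n → Triple m) (i : Fin n) (k : Fin 3) (c : Fin m) :
    estimatorField N L β t ζ i k c = -(β k * Real.sign (disagreement N L t ζ i k c)) := rfl

theorem abs_sign_le_one (x : ℝ) : |Real.sign x| ≤ 1 := by
  rcases Real.sign_apply_eq x with h | h | h <;> simp [h]

section Projection

variable {E : Type*} [NormedAddCommGroup E] [NormedSpace ℝ E] [MeasureSpace E]
  {n m : ℕ} {N : Network n} {L : Leader m} {β : Fin 3 → ℝ} {f : ℝ → E → E} {t : ℝ} {z w : E}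
  {π : E →L[ℝ] (Fin n → Triple m)}

/-- The evaluation of a component of the stacked triples. -/
def blockEval (n m : ℕ) (i : Fin n) (k : Fin 3) (c : Fin m) : (Fin n → Triple m) →L[ℝ] ℝ :=
  (ContinuousLinearMap.proj (R := ℝ) (φ := fun _ : Fin m => ℝ) c).comp
    ((ContinuousLinearMap.proj (φ := fun _ : Fin 3 => Fin m → ℝ) k).comp
      (ContinuousLinearMap.proj (φ := fun _ : Fin n => Triple m) i))

@[simp] theorem blockEval_apply (n m : ℕ) (i : Fin n) (k : Fin 3) (c : Fin m)
    (ζ : Fin n → Triple m) : blockEval n m i k c ζ = ζ i k c := rfl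

/-- Off the switching surface the signum is locally constant. The projection `π` lets the same
argument serve the estimator alone and the closed loop, without projecting Filippov sets. -/
theorem filippov_estimator_eq (hw : w ∈ filippov f t z)
    (hf : ∀ z', π (f t z') = estimatorField N L β t (π z')) (i : Fin n) (k : Fin 3) (c : Fin m) :
    (0 < disagreement N L t (π z) i k c → π w i k c = -β k) ∧
      (disagreement N L t (π z) i k c < 0 → π w i k c = β k) := by
  have hcont : ContinuousAt (fun z' => disagreement N L t (π z') i k c) z :=
    ((disagreement_continuous N L t i k c).comp π.continuous).continuousAt
  constructor <;> intro h
  · refine filippov_eq hw ((blockEval n m i k c).comp π) (Ψ := fun _ => -β k)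
      continuousAt_const ?_
    filter_upwards [hcont.eventually_const_lt h] with z' hz'
    simp [hf, estimatorField_apply, Real.sign_of_pos hz']
  · refine filippov_eq hw ((blockEval n m i k c).comp π) (Ψ := fun _ => β k)
      continuousAt_const ?_
    filter_upwards [hcont.eventually_lt_const h] with z' hz'
    simp [hf, estimatorField_apply, Real.sign_of_neg hz']

theorem filippov_estimator_abs_le (hβ : ∀ k, 0 ≤ β k) (hw : w ∈ filippov f t z)
    (hf : ∀ z', π (f t z') = estimatorField N L β t (π z')) (i : Fin n) (k : Fin 3) (c : Fin m) :
    |π w i k c| ≤ β k := by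
  have hb (z' : E) : |π (f t z') i k c| ≤ β k := by
    rw [hf, estimatorField_apply, abs_neg, abs_mul, abs_of_nonneg (hβ k)]
    exact mul_le_of_le_one_right (hβ k) (abs_sign_le_one _)
  rw [abs_le]
  constructor
  · have := filippov_le hw (-((blockEval n m i k c).comp π)) (Ψ := fun _ => β k)
      continuousAt_const (Eventually.of_forall fun z' => by
        have := (abs_le.1 (hb z')).1
        simp only [_root_.neg_apply, ContinuousLinearMap.comp_apply, blockEval_apply]
        linarith)
    simp only [_root_.neg_apply, ContinuousLinearMap.comp_apply,
      blockEval_apply] at this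
    linarith
  · exact filippov_le hw ((blockEval n m i k c).comp π) (Ψ := fun _ => β k)
      continuousAt_const (Eventually.of_forall fun z' => (abs_le.1 (hb z')).2)

theorem IsFilippovSolution.isSlidingCurve {t₀ : ℝ} {T : EReal} {z : ℝ → E}
    (hz : IsFilippovSolution f t₀ T z)
    (hf : ∀ t z', π (f t z') = estimatorField N L β t (π z')) :
    IsSlidingCurve N L β t₀ T fun t => π (z t) := by
  refine ⟨fun t ht => (hz.1 t ht).comp_contDiffAt fun s _ => π.contDiff.contDiffAt, ?_⟩
  filter_upwards [hz.2] with t h ht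
  obtain ⟨w, hw, hd⟩ := h ht
  exact ⟨π w, π.hasFDerivAt.comp_hasDerivAt t hd, filippov_estimator_eq hw (hf t)⟩

end Projection

/-! ### Smoothness and continuity of matrix expressions -/

section MatrixCalculus

variable {E : Type*} [NormedAddCommGroup E] [NormedSpace ℝ E] {ι κ l : Type*}
  {x : E} {k : WithTop ℕ∞}

theorem contDiffAt_matrix_mul [Fintype κ] {A : E → Matrix ι κ ℝ} {B : E → Matrix κ l ℝ}
    (hA : ∀ a b, ContDiffAt ℝ k (fun y => A y a b) x)
    (hB : ∀ a b, ContDiffAt ℝ k (fun y => B y a b) x) (a : ι) (b : l) :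
    ContDiffAt ℝ k (fun y => (A y * B y) a b) x := by
  simp only [Matrix.mul_apply]
  exact ContDiffAt.sum fun c _ => (hA a c).mul (hB c b)

theorem contDiffAt_mulVec [Fintype ι] [Fintype κ] {A : E → Matrix ι κ ℝ} {v : E → κ → ℝ}
    (hA : ∀ a b, ContDiffAt ℝ k (fun y => A y a b) x) (hv : ContDiffAt ℝ k v x) :
    ContDiffAt ℝ k (fun y => A y *ᵥ v y) x :=
  contDiffAt_pi.2 fun a => ContDiffAt.sum fun c _ => (hA a c).mul (contDiffAt_pi.1 hv c)

theorem contDiffAt_dotProduct [Fintype ι] {v w : E → ι → ℝ} (hv : ContDiffAt ℝ k v x)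
    (hw : ContDiffAt ℝ k w x) : ContDiffAt ℝ k (fun y => v y ⬝ᵥ w y) x :=
  ContDiffAt.sum fun c _ => (contDiffAt_pi.1 hv c).mul (contDiffAt_pi.1 hw c)

theorem contDiffAt_det [Fintype ι] [DecidableEq ι] {A : E → Matrix ι ι ℝ}
    (hA : ∀ a b, ContDiffAt ℝ k (fun y => A y a b) x) :
    ContDiffAt ℝ k (fun y => (A y).det) x := by
  simp only [Matrix.det_apply]
  exact ContDiffAt.sum fun σ _ => (contDiffAt_prod fun c _ => hA (σ c) c).const_smul _

/-- Cramer's rule: the entries are cofactors divided by a nonvanishing determinant. -/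
theorem contDiffAt_matrix_inv [Fintype ι] [DecidableEq ι] {A : E → Matrix ι ι ℝ}
    (hA : ∀ a b, ContDiffAt ℝ k (fun y => A y a b) x) (h : (A x).det ≠ 0) (a b : ι) :
    ContDiffAt ℝ k (fun y => (A y)⁻¹ a b) x := by
  have hadj : ContDiffAt ℝ k (fun y => (A y).adjugate a b) x := by
    simp only [Matrix.adjugate_apply]
    refine contDiffAt_det fun c d => ?_
    simp only [Matrix.updateRow_apply]
    split_ifs
    · exact contDiffAt_const
    · exact hA c d
  simp only [Matrix.inv_def, Ring.inverse_eq_inv', Matrix.smul_apply, smul_eq_mul]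
  exact ((contDiffAt_det hA).inv h).mul hadj

variable {X : Type*} [TopologicalSpace X] {z : X}

theorem continuousAt_mulVec [Fintype κ] {A : X → Matrix ι κ ℝ} {v : X → κ → ℝ}
    (hA : ContinuousAt A z) (hv : ContinuousAt v z) : ContinuousAt (fun y => A y *ᵥ v y) z :=
  ContinuousAt.comp (g := fun q : Matrix ι κ ℝ × (κ → ℝ) => q.1 *ᵥ q.2)
    (continuous_fst.matrix_mulVec continuous_snd).continuousAt (hA.prodMk hv)

theorem continuousAt_matrix_mul [Fintype κ] {A : X → Matrix ι κ ℝ} {B : X → Matrix κ l ℝ}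
    (hA : ContinuousAt A z) (hB : ContinuousAt B z) : ContinuousAt (fun y => A y * B y) z :=
  ContinuousAt.comp (g := fun q : Matrix ι κ ℝ × Matrix κ l ℝ => q.1 * q.2)
    (continuous_fst.matrix_mul continuous_snd).continuousAt (hA.prodMk hB)

theorem continuousAt_matrix {A : X → Matrix ι κ ℝ}
    (hA : ∀ a b, ContinuousAt (fun y => A y a b) z) : ContinuousAt A z :=
  continuousAt_pi.2 fun a => continuousAt_pi.2 fun b => hA a b

theorem continuousAt_transpose {A : X → Matrix ι κ ℝ} (hA : ContinuousAt A z) :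
    ContinuousAt (fun y => (A y)ᵀ) z :=
  ContinuousAt.comp (g := fun B : Matrix ι κ ℝ => Bᵀ)
    continuous_id.matrix_transpose.continuousAt hA

theorem continuousAt_dotProduct [Fintype ι] {v w : X → ι → ℝ} (hv : ContinuousAt v z)
    (hw : ContinuousAt w z) : ContinuousAt (fun y => v y ⬝ᵥ w y) z :=
  ContinuousAt.comp (g := fun q : (ι → ℝ) × (ι → ℝ) => q.1 ⬝ᵥ q.2)
    (continuous_fst.dotProduct continuous_snd).continuousAt (hv.prodMk hw)

end MatrixCalculus

theorem det_mul_transpose_ne_zero {m p : ℕ} {A : Matrix (Fin m) (Fin p) ℝ} (hA : A.rank = m) :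
    (A * Aᵀ).det ≠ 0 := by
  have h : (A * Aᵀ).rank = m := by rw [Matrix.rank_self_mul_transpose, hA]
  have hsurj : Function.Surjective (A * Aᵀ).mulVec := by
    have : LinearMap.range (A * Aᵀ).mulVecLin = ⊤ :=
      Submodule.eq_top_of_finrank_eq (by simpa [Matrix.rank] using h)
    exact LinearMap.range_eq_top.1 this
  exact ((Matrix.isUnit_iff_isUnit_det _).1 (Matrix.mulVec_surjective_iff_isUnit.1 hsurj)).ne_zero

/-- The state of one manipulator together with its estimate of the leader. -/
abbrev AgentState (m p r : ℕ) : Type :=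
  ((Fin p → ℝ) × (Fin p → ℝ) × (Fin r → ℝ)) × Triple m

/-! ### Regularity of the reference signals at nonsingular configurations -/

section Regularity

variable {m p r : ℕ} {M : Manipulator m p r} {G : Controller m p r} {t₀ : ℝ}

theorem Manipulator.J_mulVec (M : Manipulator m p r) (q v : Fin p → ℝ) :
    M.J q *ᵥ v = fderiv ℝ M.ψ q v := by
  have h : v = ∑ b, v b • (Pi.single b 1 : Fin p → ℝ) := by
    simpa using (pi_eq_sum_univ' v)
  conv_rhs => rw [h, map_sum]
  ext a
  simp [Matrix.mulVec, dotProduct, Manipulator.J, mul_comm]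

theorem Manipulator.IsRegular.contDiff_J (hM : M.IsRegular t₀) (a : Fin m) (b : Fin p) :
    ContDiff ℝ 1 fun q => M.J q a b := by
  have h : ContDiff ℝ 1 (fderiv ℝ M.ψ) := hM.ψ_smooth.fderiv_right (by norm_num)
  exact contDiff_pi.1 (h.clm_apply contDiff_const) a

/-- Full rank makes det(JJᵀ) nonzero at q, hence in a neighbourhood, so `D` need not be open. -/
theorem Manipulator.IsRegular.contDiffAt_Jsharp (hM : M.IsRegular t₀) {q : Fin p → ℝ}
    (hq : q ∈ M.D) (a : Fin p) (b : Fin m) : ContDiffAt ℝ 1 (fun q => M.Jsharp q a b) q := by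
  have hJ (a : Fin m) (b : Fin p) : ContDiffAt ℝ 1 (fun q => M.J q a b) q :=
    (hM.contDiff_J a b).contDiffAt
  exact contDiffAt_matrix_mul (A := fun q => (M.J q)ᵀ) (B := fun q => (M.J q * (M.J q)ᵀ)⁻¹)
    (fun a b => hJ b a)
    (contDiffAt_matrix_inv (contDiffAt_matrix_mul hJ fun a b => hJ b a)
      (det_mul_transpose_ne_zero (hM.J_rank q hq))) a b

theorem Manipulator.IsRegular.contDiffAt_nullTerm (hM : M.IsRegular t₀)
    (hG : G.IsAdmissible t₀) (t : ℝ) {q : Fin p → ℝ} (hq : q ∈ M.D) :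
    ContDiffAt ℝ 1 (fun x : ℝ × (Fin p → ℝ) => nullTerm M G x.1 x.2) (t, q) := by
  refine contDiffAt_mulVec (A := fun x : ℝ × (Fin p → ℝ) => 1 - M.Jsharp x.2 * M.J x.2)
    (fun a b => ?_) hG.φ_smooth.contDiffAt
  simp only [Matrix.sub_apply]
  refine contDiffAt_const.sub (contDiffAt_matrix_mul (A := fun x : ℝ × (Fin p → ℝ) => M.Jsharp x.2)
    (B := fun x : ℝ × (Fin p → ℝ) => M.J x.2) (fun a b => ?_) (fun a b => ?_) a b)
  · exact ContDiffAt.comp (t, q) (g := fun q => M.Jsharp q a b) (hM.contDiffAt_Jsharp hq a b)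
      contDiffAt_snd
  · exact ContDiffAt.comp (t, q) (g := fun q => M.J q a b) (hM.contDiff_J a b).contDiffAt
      contDiffAt_snd

theorem Manipulator.IsRegular.contDiffAt_refVel (hM : M.IsRegular t₀)
    (hG : G.IsAdmissible t₀) {x : ℝ × AgentState m p r} (hq : x.2.1.1 ∈ M.D) :
    ContDiffAt ℝ 1 (fun x : ℝ × AgentState m p r => refVel M G x.1 x.2.1.1 x.2.2) x := by
  refine ContDiffAt.add (contDiffAt_mulVec
    (A := fun x : ℝ × AgentState m p r => M.Jsharp x.2.1.1) (fun a b => ?_) ?_) ?_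
  · exact ContDiffAt.comp x (g := fun q => M.Jsharp q a b) (hM.contDiffAt_Jsharp hq a b)
      (f := fun x : ℝ × AgentState m p r => x.2.1.1) (by fun_prop)
  · have hψ : ContDiff ℝ 1 M.ψ := hM.ψ_smooth.of_le (by norm_num)
    fun_prop
  · exact ContDiffAt.comp x (g := fun x : ℝ × (Fin p → ℝ) => nullTerm M G x.1 x.2)
      (hM.contDiffAt_nullTerm hG x.1 hq)
      (f := fun x : ℝ × AgentState m p r => (x.1, x.2.1.1)) (by fun_prop)

theorem Manipulator.IsRegular.contDiffAt_slide (hM : M.IsRegular t₀)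
    (hG : G.IsAdmissible t₀) {x : ℝ × AgentState m p r} (hq : x.2.1.1 ∈ M.D) :
    ContDiffAt ℝ 1 (fun x : ℝ × AgentState m p r => slide M G x.1 x.2.1.1 x.2.1.2.1 x.2.2) x :=
  ContDiffAt.sub (by fun_prop) (hM.contDiffAt_refVel hG hq)

variable {t : ℝ} {y : AgentState m p r}

theorem Manipulator.IsRegular.continuousAt_slide (hM : M.IsRegular t₀) (hG : G.IsAdmissible t₀)
    (t : ℝ) (hq : y.1.1 ∈ M.D) :
    ContinuousAt (fun y : AgentState m p r => slide M G t y.1.1 y.1.2.1 y.2) y :=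
  ContinuousAt.comp (f := fun y : AgentState m p r => (t, y))
    (hM.contDiffAt_slide hG (x := (t, y)) hq).continuousAt (by fun_prop)

theorem Manipulator.IsRegular.continuousAt_refVel (hM : M.IsRegular t₀) (hG : G.IsAdmissible t₀)
    (t : ℝ) (hq : y.1.1 ∈ M.D) :
    ContinuousAt (fun y : AgentState m p r => refVel M G t y.1.1 y.2) y :=
  ContinuousAt.comp (f := fun y : AgentState m p r => (t, y))
    (hM.contDiffAt_refVel hG (x := (t, y)) hq).continuousAt (by fun_prop)

theorem Manipulator.IsRegular.continuous_J (hM : M.IsRegular t₀) : Continuous M.J :=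
  continuous_matrix fun a b => (hM.contDiff_J a b).continuous

theorem Manipulator.IsRegular.continuous_H (hM : M.IsRegular t₀) : Continuous M.H :=
  continuous_matrix fun a b => (hM.H_smooth a b).continuous

theorem Manipulator.IsRegular.continuousAt_refAcc (hM : M.IsRegular t₀) (hG : G.IsAdmissible t₀)
    (t : ℝ) (hq : y.1.1 ∈ M.D) :
    ContinuousAt (fun y : AgentState m p r => refAcc M G t y.1.1 y.1.2.1 y.2) y := by
  have hqc : ContinuousAt (fun y : AgentState m p r => y.1.1) y := by fun_prop
  have hvc : ContinuousAt (fun y : AgentState m p r => y.1.2.1) y := by fun_prop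
  have hψ : Continuous M.ψ := hM.ψ_smooth.continuous
  refine ContinuousAt.add (ContinuousAt.add (continuousAt_mulVec ?_ ?_)
    (continuousAt_mulVec ?_ ?_)) ?_
  · refine continuousAt_matrix fun a b => ?_
    have h := (hM.contDiffAt_Jsharp hq a b).continuousAt_fderiv (by norm_num)
    exact (ContinuousAt.comp (f := fun y : AgentState m p r => y.1.1) h hqc).clm_apply hvc
  · fun_prop
  · exact continuousAt_matrix fun a b => ContinuousAt.comp
      (f := fun y : AgentState m p r => y.1.1) (hM.contDiffAt_Jsharp hq a b).continuousAt hqc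
  · have hJ : ContinuousAt (fun y : AgentState m p r => M.J y.1.1 *ᵥ y.1.2.1) y :=
      continuousAt_mulVec (hM.continuous_J.continuousAt.comp hqc) hvc
    have h1 : ContinuousAt (fun y : AgentState m p r => y.2 1) y := by fun_prop
    have h2 : ContinuousAt (fun y : AgentState m p r => y.2 2) y := by fun_prop
    exact h2.sub ((continuousAt_const (y := G.α)).smul (hJ.sub h1))
  · have h := (hM.contDiffAt_nullTerm hG t hq).continuousAt_fderiv (by norm_num)
    exact (ContinuousAt.comp (f := fun y : AgentState m p r => (t, y.1.1)) h
      (by fun_prop)).clm_apply (by fun_prop)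

theorem Manipulator.IsRegular.continuousAt_regressorHat (hM : M.IsRegular t₀)
    (hG : G.IsAdmissible t₀) (t : ℝ) (hq : y.1.1 ∈ M.D) :
    ContinuousAt (fun y : AgentState m p r => regressorHat M G t y.1.1 y.1.2.1 y.2) y := by
  refine continuousAt_matrix fun a b => ?_
  have hqc : ContinuousAt (fun y : AgentState m p r => y.1.1) y := by fun_prop
  have hvc : ContinuousAt (fun y : AgentState m p r => y.1.2.1) y := by fun_prop
  exact ContinuousAt.comp (f := fun y : AgentState m p r => (y.1.1, y.1.2.1,
    refVel M G t y.1.1 y.2, refAcc M G t y.1.1 y.1.2.1 y.2)) (hM.Y_cont a b).continuousAt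
    (hqc.prodMk (hvc.prodMk ((hM.continuousAt_refVel hG t hq).prodMk
      (hM.continuousAt_refAcc hG t hq))))

end Regularity

/-! ### The energy of a manipulator along the closed loop -/

section Energy

variable {m p r : ℕ} {M : Manipulator m p r} {G : Controller m p r} {t₀ : ℝ}

/-- The functional `a ⬝ q'' + b ⬝ θ'` on the velocities of the state of a manipulator. -/
noncomputable def velParamFunctional (m : ℕ) {p r : ℕ} (a : Fin p → ℝ) (b : Fin r → ℝ) :
    AgentState m p r →L[ℝ] ℝ :=
  LinearMap.toContinuousLinearMap
    { toFun := fun w => a ⬝ᵥ w.1.2.1 + b ⬝ᵥ w.1.2.2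
      map_add' := fun w w' => by simp only [Prod.fst_add, Prod.snd_add, dotProduct_add]; ring
      map_smul' := fun k w => by
        simp only [Prod.smul_fst, Prod.smul_snd, dotProduct_smul, smul_eq_mul, RingHom.id_apply]
        ring }

@[simp] theorem velParamFunctional_apply (a : Fin p → ℝ) (b : Fin r → ℝ)
    (w : AgentState m p r) : velParamFunctional m a b w = a ⬝ᵥ w.1.2.1 + b ⬝ᵥ w.1.2.2 := rfl

theorem dotProduct_neg_sgn_le {k : ℕ} (u σ : Fin k → ℝ) : -(u ⬝ᵥ sgn σ) ≤ ∑ a, |u a| := by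
  rw [dotProduct, ← Finset.sum_neg_distrib]
  refine Finset.sum_le_sum fun a _ => (neg_le_abs _).trans ?_
  rw [abs_mul]
  exact mul_le_of_le_one_right (abs_nonneg _) (abs_sign_le_one _)

theorem Manipulator.IsRegular.H_transpose (hM : M.IsRegular t₀) (q : Fin p → ℝ) :
    (M.H q)ᵀ = M.H q := by
  have := (hM.H_posDef q).isHermitian
  rwa [Matrix.IsHermitian, Matrix.conjTranspose_eq_transpose_of_trivial] at this

theorem Manipulator.IsRegular.H_mulVec_dotProduct (hM : M.IsRegular t₀) (q s u : Fin p → ℝ) :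
    (M.H q *ᵥ s) ⬝ᵥ u = s ⬝ᵥ (M.H q *ᵥ u) := by
  rw [dotProduct_mulVec, ← Matrix.mulVec_transpose, hM.H_transpose]

theorem Manipulator.IsRegular.det_H_ne_zero (hM : M.IsRegular t₀) (q : Fin p → ℝ) :
    (M.H q).det ≠ 0 :=
  (hM.H_posDef q).det_pos.ne'

theorem Manipulator.IsRegular.vecMul_H_inv (hM : M.IsRegular t₀) (q s : Fin p → ℝ) :
    (M.H q *ᵥ s) ᵥ* (M.H q)⁻¹ = s := by
  rw [← Matrix.vecMul_transpose, hM.H_transpose, Matrix.vecMul_vecMul,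
    Matrix.mul_nonsing_inv _ (isUnit_iff_ne_zero.2 (hM.det_H_ne_zero q)), Matrix.vecMul_one]

section Inclusion

variable {E : Type*} [NormedAddCommGroup E] [NormedSpace ℝ E] [MeasureSpace E]
  {f : ℝ → E → E} {t : ℝ} {z w : E} {π : E →L[ℝ] AgentState m p r}

theorem filippov_agent_vel (hw : w ∈ filippov f t z)
    (hf : ∀ z', (π (f t z')).1 = localField M G t (π z').1 (π z').2) :
    (π w).1.1 = (π z).1.2.1 := by
  funext a
  let l : AgentState m p r →L[ℝ] ℝ :=
    (ContinuousLinearMap.proj (R := ℝ) (φ := fun _ : Fin p => ℝ) a).comp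
      ((ContinuousLinearMap.fst ℝ _ _).comp (ContinuousLinearMap.fst ℝ _ _))
  have hc : Continuous fun z' => (π z').1.2.1 a := by
    have := π.continuous
    fun_prop
  refine filippov_eq hw (l.comp π) (Ψ := fun z' => (π z').1.2.1 a) hc.continuousAt
    (Eventually.of_forall fun z' => ?_)
  change (π (f t z')).1.1 a = _
  rw [hf]
  rfl

/-- The functional is the part of the energy derivative carried by q'' and θ', with coefficients
frozen at the state. The signum term is replaced by an upper bound valid for every sign pattern,
which makes the majorant continuous. As `Kr` need not be diagonal, this term is not claimed to be
dissipative. -/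
theorem filippov_agent_le (hM : M.IsRegular t₀) (hG : G.IsAdmissible t₀)
    (hw : w ∈ filippov f t z)
    (hf : ∀ z', (π (f t z')).1 = localField M G t (π z').1 (π z').2)
    {q v : Fin p → ℝ} {θ : Fin r → ℝ} {ζ : Triple m} (hz : π z = ((q, v, θ), ζ)) (hq : q ∈ M.D)
    {s : Fin p → ℝ} (hs : s = slide M G t q v ζ) :
    (M.H q *ᵥ s) ⬝ᵥ (π w).1.2.1 + (fun a => (θ a - M.ϑ a) / G.τ a) ⬝ᵥ (π w).1.2.2 ≤
      s ⬝ᵥ (M.H q *ᵥ refAcc M G t q v ζ - M.C q v *ᵥ s - ((M.J q)ᵀ * G.Kx * M.J q) *ᵥ s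
        - G.Ks *ᵥ s - M.d t) + ∑ a, |(s ᵥ* G.Kr) a| := by
  set u := M.H q *ᵥ s with hu
  set b : Fin r → ℝ := fun a => (θ a - M.ϑ a) / G.τ a with hb
  let S : AgentState m p r → Fin p → ℝ := fun y => slide M G t y.1.1 y.1.2.1 y.2
  let Yh : AgentState m p r → Matrix (Fin p) (Fin r) ℝ :=
    fun y => regressorHat M G t y.1.1 y.1.2.1 y.2
  let F : AgentState m p r → Fin p → ℝ := fun y => Yh y *ᵥ y.1.2.2
    - ((M.J y.1.1)ᵀ * G.Kx * M.J y.1.1) *ᵥ S y - G.Ks *ᵥ S y - M.C y.1.1 y.1.2.1 *ᵥ y.1.2.1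
    - M.g y.1.1 - M.d t
  let Ψ : AgentState m p r → ℝ := fun y => u ⬝ᵥ ((M.H y.1.1)⁻¹ *ᵥ F y)
    + ∑ a, |(u ᵥ* ((M.H y.1.1)⁻¹ * G.Kr)) a| - b ⬝ᵥ ((Matrix.diagonal G.τ * (Yh y)ᵀ) *ᵥ S y)
  have hq' : (π z).1.1 ∈ M.D := by rw [hz]; exact hq
  have hΨ : ContinuousAt Ψ (π z) := by
    have hqc : ContinuousAt (fun y : AgentState m p r => y.1.1) (π z) := by fun_prop
    have hvc : ContinuousAt (fun y : AgentState m p r => y.1.2.1) (π z) := by fun_prop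
    have hθc : ContinuousAt (fun y : AgentState m p r => y.1.2.2) (π z) := by fun_prop
    have hS : ContinuousAt S (π z) := hM.continuousAt_slide hG t hq'
    have hY : ContinuousAt Yh (π z) := hM.continuousAt_regressorHat hG t hq'
    have hJ : ContinuousAt (fun y : AgentState m p r => M.J y.1.1) (π z) :=
      hM.continuous_J.continuousAt.comp hqc
    have hHinv : ContinuousAt (fun y : AgentState m p r => (M.H y.1.1)⁻¹) (π z) :=
      continuousAt_matrix fun a b => ContinuousAt.comp
        (f := fun y : AgentState m p r => y.1.1) (g := fun q => (M.H q)⁻¹ a b)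
        (contDiffAt_matrix_inv (fun a b => (hM.H_smooth a b).contDiffAt)
          (hM.det_H_ne_zero _) a b).continuousAt hqc
    have hC : ContinuousAt (fun y : AgentState m p r => M.C y.1.1 y.1.2.1) (π z) :=
      continuousAt_matrix fun a b => ContinuousAt.comp
        (f := fun y : AgentState m p r => (y.1.1, y.1.2.1)) (hM.C_cont a b).continuousAt
        (hqc.prodMk hvc)
    have hF : ContinuousAt F (π z) :=
      (((((continuousAt_mulVec hY hθc).sub (continuousAt_mulVec (continuousAt_matrix_mul
        (continuousAt_matrix_mul (continuousAt_transpose hJ) continuousAt_const) hJ) hS)).sub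
        (continuousAt_mulVec continuousAt_const hS)).sub (continuousAt_mulVec hC hvc)).sub
        (hM.g_cont.continuousAt.comp hqc)).sub continuousAt_const
    refine ((continuousAt_dotProduct continuousAt_const (continuousAt_mulVec hHinv hF)).add
      ?_).sub (continuousAt_dotProduct continuousAt_const (continuousAt_mulVec
        (continuousAt_matrix_mul continuousAt_const (continuousAt_transpose hY)) hS))
    simp only [← Matrix.mulVec_transpose]
    exact tendsto_finsetSum _ fun a _ => (continuousAt_pi.1 (continuousAt_mulVec
      (continuousAt_transpose (continuousAt_matrix_mul hHinv continuousAt_const))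
      continuousAt_const) a).abs
  have hle := filippov_le hw ((velParamFunctional m u b).comp π) (Ψ := fun z' => Ψ (π z'))
    (ContinuousAt.comp hΨ π.continuous.continuousAt) (Eventually.of_forall fun z' => by
      simp only [ContinuousLinearMap.comp_apply, velParamFunctional_apply, hf]
      have hv : (localField M G t (π z').1 (π z').2).2.1 = (M.H (π z').1.1)⁻¹ *ᵥ F (π z') -
          ((M.H (π z').1.1)⁻¹ * G.Kr) *ᵥ sgn (S (π z')) := by
        rw [← Matrix.mulVec_mulVec, ← Matrix.mulVec_sub]
        simp only [localField, control, F, S, Yh]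
        congr 1
        abel
      have hp : (localField M G t (π z').1 (π z').2).2.2 =
          -((Matrix.diagonal G.τ * (Yh (π z'))ᵀ) *ᵥ S (π z')) := rfl
      rw [hv, hp, dotProduct_sub, dotProduct_mulVec u _ (sgn _), dotProduct_neg]
      have := dotProduct_neg_sgn_le (u ᵥ* ((M.H (π z').1.1)⁻¹ * G.Kr)) (S (π z'))
      simp only [Ψ]
      linarith)
  simp only [ContinuousLinearMap.comp_apply, velParamFunctional_apply] at hle
  refine hle.trans (le_of_eq ?_)
  have hS : S (π z) = s := by simp only [S, hz, hs]
  have hY : Yh (π z) = M.Y q v (refVel M G t q ζ) (refAcc M G t q v ζ) := by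
    simp only [Yh, hz, regressorHat]
  have h1 : u ⬝ᵥ ((M.H q)⁻¹ *ᵥ F (π z)) = s ⬝ᵥ F (π z) := by
    rw [dotProduct_mulVec, hu, hM.vecMul_H_inv]
  have h2 : u ᵥ* ((M.H q)⁻¹ * G.Kr) = s ᵥ* G.Kr := by
    rw [← Matrix.vecMul_vecMul, hu, hM.vecMul_H_inv]
  -- The weights 1/τ in `b` undo the adaptation gain, so adaptation cancels the parameter error in
  -- `F`.
  have h3 : b ⬝ᵥ ((Matrix.diagonal G.τ * (Yh (π z))ᵀ) *ᵥ s) =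
      s ⬝ᵥ (Yh (π z) *ᵥ (θ - M.ϑ)) := by
    rw [dotProduct_mulVec s, ← Matrix.mulVec_transpose, ← Matrix.mulVec_mulVec, dotProduct,
      dotProduct]
    refine Finset.sum_congr rfl fun a _ => ?_
    rw [Matrix.mulVec_diagonal, hb, Pi.sub_apply]
    have := (hG.τ_pos a).ne'
    field_simp
  have hreg := hM.regressor q v (refVel M G t q ζ) (refAcc M G t q v ζ)
  have hF : F (π z) = Yh (π z) *ᵥ (θ - M.ϑ) + (M.H q *ᵥ refAcc M G t q v ζ - M.C q v *ᵥ s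
      - ((M.J q)ᵀ * G.Kx * M.J q) *ᵥ s - G.Ks *ᵥ s - M.d t) := by
    have hCs : M.C q v *ᵥ s = M.C q v *ᵥ v - M.C q v *ᵥ refVel M G t q ζ := by
      rw [hs, slide, Matrix.mulVec_sub]
    have hF₀ : F (π z) = Yh (π z) *ᵥ θ - ((M.J q)ᵀ * G.Kx * M.J q) *ᵥ S (π z)
        - G.Ks *ᵥ S (π z) - M.C q v *ᵥ v - M.g q - M.d t := by
      simp only [F, hz]
    rw [hF₀, hS, Matrix.mulVec_sub, hCs, hY, ← hreg]
    abel
  simp only [Ψ, hS]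
  rw [h3, hz]
  simp only
  rw [← hz, h1, h2, hF, dotProduct_add]
  ring

end Inclusion

/-- Half the kinetic energy of the sliding variable plus the weighted parameter error. -/
noncomputable def energy (M : Manipulator m p r) (G : Controller m p r) (t : ℝ) (y : AgentState m p r) : ℝ :=
  1 / 2 * (slide M G t y.1.1 y.1.2.1 y.2 ⬝ᵥ (M.H y.1.1 *ᵥ slide M G t y.1.1 y.1.2.1 y.2))
    + 1 / 2 * ∑ a, (y.1.2.2 a - M.ϑ a) ^ 2 / G.τ a

/-! ### Differentiating the energy along a curve -/

section Derivatives

variable {ι κ : Type*} {t : ℝ}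

theorem hasDerivAt_mulVec [Fintype ι] [Fintype κ] {A : ℝ → Matrix ι κ ℝ} {A' : Matrix ι κ ℝ} {v : ℝ → κ → ℝ} {v' : κ → ℝ}
    (hA : ∀ a b, HasDerivAt (fun s => A s a b) (A' a b) t) (hv : HasDerivAt v v' t) :
    HasDerivAt (fun s => A s *ᵥ v s) (A' *ᵥ v t + A t *ᵥ v') t := by
  refine hasDerivAt_pi.2 fun a => ?_
  have := HasDerivAt.fun_sum (u := Finset.univ)
    fun b _ => (hA a b).fun_mul (hasDerivAt_pi.1 hv b)
  rw [Finset.sum_add_distrib] at this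
  exact this

theorem hasDerivAt_dotProduct [Fintype ι] {v w : ℝ → ι → ℝ} {v' w' : ι → ℝ} (hv : HasDerivAt v v' t)
    (hw : HasDerivAt w w' t) :
    HasDerivAt (fun s => v s ⬝ᵥ w s) (v' ⬝ᵥ w t + v t ⬝ᵥ w') t := by
  have := HasDerivAt.fun_sum (u := Finset.univ)
    fun b _ => (hasDerivAt_pi.1 hv b).fun_mul (hasDerivAt_pi.1 hw b)
  rw [Finset.sum_add_distrib] at this
  exact this

theorem hasDerivAt_matrix_comp {A : (Fin p → ℝ) → Matrix (Fin m) (Fin r) ℝ} {q : ℝ → Fin p → ℝ}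
    {v : Fin p → ℝ} (hA : ∀ a b, DifferentiableAt ℝ (fun x => A x a b) (q t))
    (hq : HasDerivAt q v t) (a : Fin m) (b : Fin r) :
    HasDerivAt (fun s => A (q s) a b) (matDeriv A (q t) v a b) t :=
  (hA a b).hasFDerivAt.comp_hasDerivAt t hq

theorem hasDerivAt_forwardKinematics (hM : M.IsRegular t₀) {q : ℝ → Fin p → ℝ} {v : Fin p → ℝ}
    (hq : HasDerivAt q v t) : HasDerivAt (fun s => M.ψ (q s)) (M.J (q t) *ᵥ v) t := by
  rw [M.J_mulVec]
  exact ((hM.ψ_smooth.differentiable (by norm_num)) (q t)).hasFDerivAt.comp_hasDerivAt t hq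

/-- `refAcc` uses v̂ and â where the true derivative has x̂' and v̂'; the last summand is this
discrepancy, present until the estimator settles. -/
theorem hasDerivAt_refVel (hM : M.IsRegular t₀) (hG : G.IsAdmissible t₀)
    {q : ℝ → Fin p → ℝ} {v : Fin p → ℝ} {ζ : ℝ → Triple m} {ζ' : Triple m}
    (hq : HasDerivAt q v t) (hζ : HasDerivAt ζ ζ' t) (hD : q t ∈ M.D) :
    HasDerivAt (fun s => refVel M G s (q s) (ζ s)) (refAcc M G t (q t) v (ζ t) +
      M.Jsharp (q t) *ᵥ ((ζ' 1 - ζ t 2) + G.α • (ζ' 0 - ζ t 1))) t := by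
  have hJs := hasDerivAt_matrix_comp
    (fun a b => (hM.contDiffAt_Jsharp hD a b).differentiableAt (by norm_num)) hq
  have hζk := hasDerivAt_pi.1 hζ
  have h1 := hasDerivAt_mulVec hJs ((hζk 1).sub
    (((hasDerivAt_forwardKinematics hM hq).sub (hζk 0)).const_smul G.α))
  have h2 : HasDerivAt (fun s => nullTerm M G s (q s)) (nullTermDeriv M G t (q t) v) t :=
    ((hM.contDiffAt_nullTerm hG t hD).differentiableAt (by norm_num)).hasFDerivAt.comp_hasDerivAt
      (f := fun s => (s, q s)) t ((hasDerivAt_id t).prodMk hq)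
  have h3 : ζ' 1 - G.α • (M.J (q t) *ᵥ v - ζ' 0) = (ζ t 2 - G.α • (M.J (q t) *ᵥ v - ζ t 1)) +
      ((ζ' 1 - ζ t 2) + G.α • (ζ' 0 - ζ t 1)) := by
    simp only [smul_sub]
    abel
  have h4 : refAcc M G t (q t) v (ζ t) +
      M.Jsharp (q t) *ᵥ ((ζ' 1 - ζ t 2) + G.α • (ζ' 0 - ζ t 1)) =
      matDeriv M.Jsharp (q t) v *ᵥ (ζ t 1 - G.α • (M.ψ (q t) - ζ t 0)) +
        M.Jsharp (q t) *ᵥ (ζ' 1 - G.α • (M.J (q t) *ᵥ v - ζ' 0)) +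
        nullTermDeriv M G t (q t) v := by
    rw [refAcc, h3, Matrix.mulVec_add _ (ζ t 2 - _)]
    abel
  rw [h4]
  exact h1.add h2

theorem skew_dotProduct (hM : M.IsRegular t₀) (q v s : Fin p → ℝ) :
    s ⬝ᵥ (matDeriv M.H q v *ᵥ s) = 2 * (s ⬝ᵥ (M.C q v *ᵥ s)) := by
  have h := hM.skew q v
  set A := matDeriv M.H q v - (2 : ℝ) • M.C q v with hA
  have h1 : s ⬝ᵥ (A *ᵥ s) = -(s ⬝ᵥ (A *ᵥ s)) := by
    conv_lhs => rw [dotProduct_mulVec, ← Matrix.mulVec_transpose, h, dotProduct_comm]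
    rw [Matrix.neg_mulVec, dotProduct_neg]
  have h2 : s ⬝ᵥ (A *ᵥ s) = 0 := by linarith
  rw [hA, Matrix.sub_mulVec, Matrix.smul_mulVec, dotProduct_sub, dotProduct_smul,
    smul_eq_mul] at h2
  linarith

/-- In E' the reference acceleration cancels against the one in the control, and half of sᵀH's
against sᵀCs by skew symmetry. -/
theorem energy_deriv_le (hM : M.IsRegular t₀) (hG : G.IsAdmissible t₀)
    {y : ℝ → AgentState m p r} {w : AgentState m p r} (hy : HasDerivAt y w t)
    (hD : (y t).1.1 ∈ M.D) (hv : w.1.1 = (y t).1.2.1) {s : Fin p → ℝ}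
    (hs : s = slide M G t (y t).1.1 (y t).1.2.1 (y t).2)
    (hle : (M.H (y t).1.1 *ᵥ s) ⬝ᵥ w.1.2.1 +
        (fun a => ((y t).1.2.2 a - M.ϑ a) / G.τ a) ⬝ᵥ w.1.2.2 ≤
      s ⬝ᵥ (M.H (y t).1.1 *ᵥ refAcc M G t (y t).1.1 (y t).1.2.1 (y t).2
        - M.C (y t).1.1 (y t).1.2.1 *ᵥ s - ((M.J (y t).1.1)ᵀ * G.Kx * M.J (y t).1.1) *ᵥ s
        - G.Ks *ᵥ s - M.d t) + ∑ a, |(s ᵥ* G.Kr) a|)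
    {D : ℝ} (hE : HasDerivAt (fun t => energy M G t (y t)) D t) :
    D ≤ -(s ⬝ᵥ (M.H (y t).1.1 *ᵥ (M.Jsharp (y t).1.1 *ᵥ
          ((w.2 1 - (y t).2 2) + G.α • (w.2 0 - (y t).2 1)))))
      - s ⬝ᵥ (((M.J (y t).1.1)ᵀ * G.Kx * M.J (y t).1.1) *ᵥ s) - s ⬝ᵥ (G.Ks *ᵥ s)
      - s ⬝ᵥ M.d t + ∑ a, |(s ᵥ* G.Kr) a| := by
  have hq : HasDerivAt (fun s => (y s).1.1) w.1.1 t := hy.fst.fst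
  have hvel : HasDerivAt (fun s => (y s).1.2.1) w.1.2.1 t := hy.fst.snd.fst
  have hθ : HasDerivAt (fun s => (y s).1.2.2) w.1.2.2 t := hy.fst.snd.snd
  have hζ : HasDerivAt (fun s => (y s).2) w.2 t := hy.snd
  have hS := hvel.sub (hasDerivAt_refVel hM hG hq hζ hD)
  have hH := hasDerivAt_matrix_comp (A := M.H)
    (fun a b => ((hM.H_smooth a b).differentiable (by norm_num)) (y t).1.1) hq
  have hP := HasDerivAt.fun_sum (u := Finset.univ) fun a _ =>
    (((hasDerivAt_pi.1 hθ a).sub_const (M.ϑ a)).fun_pow 2).div_const (G.τ a)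
  have hE' := ((hasDerivAt_dotProduct hS (hasDerivAt_mulVec hH hS)).const_mul (1 / 2)).add
    (hP.const_mul (1 / 2))
  have hs' : (fun s => (y s).1.2.1) t - refVel M G t (y t).1.1 (y t).2 = s := hs.symm
  have heq := hE.unique hE'
  simp only [Pi.sub_apply] at heq
  rw [heq]
  simp only [hs']
  have hpar : ∑ a, (2 : ℕ) * ((y t).1.2.2 a - M.ϑ a) ^ (2 - 1) * w.1.2.2 a / G.τ a =
      2 * ((fun a => ((y t).1.2.2 a - M.ϑ a) / G.τ a) ⬝ᵥ w.1.2.2) := by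
    rw [dotProduct, Finset.mul_sum]
    refine Finset.sum_congr rfl fun a _ => ?_
    norm_num
    ring
  rw [hpar, hv, dotProduct_add, skew_dotProduct hM, dotProduct_comm _ (M.H _ *ᵥ s),
    ← hM.H_mulVec_dotProduct, dotProduct_sub, dotProduct_add]
  simp only [dotProduct_sub, ← hM.H_mulVec_dotProduct] at hle ⊢
  linarith

end Derivatives

end Energy

/-! ### A priori bounds -/

section Norms

/-- The norm is the maximum norm, hence the factor k. -/
theorem abs_dotProduct_le {k : ℕ} (x y : Fin k → ℝ) : |x ⬝ᵥ y| ≤ k * (‖x‖ * ‖y‖) := by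
  refine (Finset.abs_sum_le_sum_abs _ _).trans ?_
  have : ∀ i ∈ Finset.univ, |x i * y i| ≤ ‖x‖ * ‖y‖ := fun i _ => by
    rw [abs_mul]
    exact mul_le_mul (norm_le_pi_norm x i) (norm_le_pi_norm y i) (abs_nonneg _) (norm_nonneg _)
  simpa using Finset.sum_le_card_nsmul _ _ _ this

theorem norm_mulVec_le {k l : ℕ} {A : Matrix (Fin k) (Fin l) ℝ} {c : ℝ}
    (hA : ∀ a b, |A a b| ≤ c) (x : Fin l → ℝ) : ‖A *ᵥ x‖ ≤ l * |c| * ‖x‖ := by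
  refine (pi_norm_le_iff_of_nonneg (by positivity)).2 fun a => ?_
  change |∑ i, A a i * x i| ≤ _
  refine (Finset.abs_sum_le_sum_abs _ _).trans ?_
  have : ∀ i ∈ Finset.univ, |A a i * x i| ≤ |c| * ‖x‖ := fun i _ => by
    rw [abs_mul]
    exact mul_le_mul ((hA a i).trans (le_abs_self c)) (norm_le_pi_norm x i) (abs_nonneg _)
      (abs_nonneg _)
  simpa [mul_assoc] using Finset.sum_le_card_nsmul _ _ _ this

theorem exists_entry_bound {k l : ℕ} (A : Matrix (Fin k) (Fin l) ℝ) :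
    ∃ c, ∀ a b, |A a b| ≤ c := by
  refine ⟨∑ a, ∑ b, |A a b|, fun a b => ?_⟩
  exact (Finset.single_le_sum (f := fun b => |A a b|) (fun _ _ => abs_nonneg _)
    (Finset.mem_univ b)).trans (Finset.single_le_sum (f := fun a => ∑ b, |A a b|)
      (fun _ _ => Finset.sum_nonneg fun _ _ => abs_nonneg _) (Finset.mem_univ a))

theorem exists_quadratic_lower_bound {X : Type*} [TopologicalSpace X] {K : Set X} {p : ℕ}
    {A : X → Matrix (Fin p) (Fin p) ℝ} (hK : IsCompact K) (hA : Continuous A)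
    (hpos : ∀ x, (A x).PosDef) : ∃ h > 0, ∀ x ∈ K, ∀ s, h * ‖s‖ ^ 2 ≤ s ⬝ᵥ (A x *ᵥ s) := by
  have hquad (x : X) (s : Fin p → ℝ) (hs : s ≠ 0) : 0 < s ⬝ᵥ (A x *ᵥ s) := by
    simpa using (hpos x).dotProduct_mulVec_pos hs
  obtain ⟨h, hh, hle⟩ : ∃ h > 0, ∀ x ∈ K, ∀ s : Fin p → ℝ, ‖s‖ = 1 → h ≤ s ⬝ᵥ (A x *ᵥ s) := by
    -- The product is empty when K is empty or p = 0; any positive constant then works.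
    rcases (K ×ˢ Metric.sphere (0 : Fin p → ℝ) 1).eq_empty_or_nonempty with he | hne
    · refine ⟨1, one_pos, fun x hx s hs => ?_⟩
      have : (x, s) ∈ K ×ˢ Metric.sphere (0 : Fin p → ℝ) 1 := ⟨hx, by simpa using hs⟩
      rw [he] at this
      exact this.elim
    · obtain ⟨⟨x₀, s₀⟩, hmem, hmin⟩ := (hK.prod (isCompact_sphere _ _)).exists_isMinOn hne
        (f := fun z : X × (Fin p → ℝ) => z.2 ⬝ᵥ (A z.1 *ᵥ z.2))
        (continuous_snd.dotProduct
          ((hA.comp continuous_fst).matrix_mulVec continuous_snd)).continuousOn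
      have hs₀ : ‖s₀‖ = 1 := by simpa using hmem.2
      refine ⟨_, hquad x₀ s₀ (by rintro rfl; simp at hs₀), fun x hx s hs => ?_⟩
      exact hmin (show (x, s) ∈ K ×ˢ Metric.sphere (0 : Fin p → ℝ) 1 from ⟨hx, by simpa using hs⟩)
  refine ⟨h, hh, fun x hx s => ?_⟩
  rcases eq_or_ne s 0 with rfl | hs
  · simp
  have hn : ‖s‖ ≠ 0 := norm_ne_zero_iff.2 hs
  have h1 := hle x hx (‖s‖⁻¹ • s) (by rw [norm_smul, norm_inv, norm_norm, inv_mul_cancel₀ hn])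
  rw [Matrix.mulVec_smul, dotProduct_smul, smul_dotProduct, smul_eq_mul, smul_eq_mul] at h1
  have h2 : ‖s‖⁻¹ * (‖s‖⁻¹ * (s ⬝ᵥ (A x *ᵥ s))) = (s ⬝ᵥ (A x *ᵥ s)) / ‖s‖ ^ 2 := by
    field_simp
  rw [h2, le_div_iff₀ (by positivity)] at h1
  exact h1

end Norms

section Bounds

variable {m p r : ℕ} {M : Manipulator m p r} {G : Controller m p r} {t₀ : ℝ}

theorem exists_energy_dissipation (hM : M.IsRegular t₀) (hG : G.IsAdmissible t₀) (Z : ℝ) :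
    ∃ c, ∃ μ > 0, ∀ t, t₀ ≤ t → ∀ q ∈ M.D, ∀ X : Fin m → ℝ, ‖X‖ ≤ Z → ∀ s : Fin p → ℝ,
      -(s ⬝ᵥ (M.H q *ᵥ (M.Jsharp q *ᵥ X))) - s ⬝ᵥ (((M.J q)ᵀ * G.Kx * M.J q) *ᵥ s)
        - s ⬝ᵥ (G.Ks *ᵥ s) - s ⬝ᵥ M.d t + ∑ a, |(s ᵥ* G.Kr) a| ≤ c * ‖s‖ - μ * ‖s‖ ^ 2 := by
  obtain ⟨cH, hH⟩ := hM.H_bdd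
  obtain ⟨cJ, hJ⟩ := hM.Jsharp_bdd
  obtain ⟨cd, hd⟩ := hM.d_bdd
  obtain ⟨cK, hK⟩ := exists_entry_bound G.Krᵀ
  obtain ⟨μ, hμ, hKs⟩ := exists_quadratic_lower_bound (X := Unit) (K := univ)
    (A := fun _ => G.Ks) isCompact_univ continuous_const fun _ => hG.Ks_posDef
  refine ⟨p * (p * |cH| * (m * |cJ| * Z)) + p * cd + p * (p * |cK|), μ, hμ, ?_⟩
  intro t ht q hq X hX s
  have h1 : |s ⬝ᵥ (M.H q *ᵥ (M.Jsharp q *ᵥ X))| ≤ p * (‖s‖ * (p * |cH| * (m * |cJ| * Z))) := by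
    refine (abs_dotProduct_le _ _).trans ?_
    gcongr
    refine (norm_mulVec_le (hH q) _).trans ?_
    gcongr
    refine (norm_mulVec_le (hJ q hq) _).trans ?_
    gcongr
  have h2 : 0 ≤ s ⬝ᵥ (((M.J q)ᵀ * G.Kx * M.J q) *ᵥ s) := by
    have h := hG.Kx_posDef.posSemidef.dotProduct_mulVec_nonneg (M.J q *ᵥ s)
    rw [star_trivial] at h
    rwa [← Matrix.mulVec_mulVec, ← Matrix.mulVec_mulVec, dotProduct_mulVec,
      Matrix.vecMul_transpose]
  have h3 := hKs () (mem_univ _) s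
  have h4 : |s ⬝ᵥ M.d t| ≤ p * (‖s‖ * cd) := by
    refine (abs_dotProduct_le _ _).trans ?_
    gcongr
    exact hd t ht
  have h5 : ∑ a, |(s ᵥ* G.Kr) a| ≤ p * (p * |cK| * ‖s‖) := by
    have : ∀ a ∈ Finset.univ, |(s ᵥ* G.Kr) a| ≤ p * |cK| * ‖s‖ := fun a _ => by
      rw [← Matrix.mulVec_transpose]
      exact (norm_le_pi_norm _ a).trans (norm_mulVec_le hK s)
    simpa using Finset.sum_le_card_nsmul _ _ _ this
  have h1' := (abs_le.1 h1).1
  have h4' := (abs_le.1 h4).1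
  linarith

theorem exists_refVel_growth (hM : M.IsRegular t₀) (hG : G.IsAdmissible t₀) (T Z : ℝ) :
    ∃ k, 0 ≤ k ∧ ∀ t, t₀ ≤ t → t ≤ T → ∀ q ∈ M.D, ∀ χ : Triple m, ‖χ‖ ≤ Z →
      ‖refVel M G t q χ‖ ≤ k * (1 + ‖q‖ + ‖M.ψ q‖) := by
  obtain ⟨cJ, hJ⟩ := hM.J_bdd
  obtain ⟨cS, hS⟩ := hM.Jsharp_bdd
  obtain ⟨cφ, hφ⟩ := hG.φ_growth T
  refine ⟨m * |cS| * (|Z| + G.α * (1 + |Z|)) + (1 + m * |cS| * (p * |cJ|)) * |cφ|, ?_, ?_⟩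
  · have := hG.α_pos.le
    positivity
  intro t ht htT q hq χ hχ
  have hα := hG.α_pos.le
  have hχ' : ‖χ‖ ≤ |Z| := hχ.trans (le_abs_self Z)
  have h1 : ‖χ 1 - G.α • (M.ψ q - χ 0)‖ ≤ |Z| + G.α * (‖M.ψ q‖ + |Z|) := by
    refine (norm_sub_le _ _).trans (add_le_add ((norm_le_pi_norm χ 1).trans hχ') ?_)
    rw [norm_smul, Real.norm_of_nonneg hα]
    exact mul_le_mul_of_nonneg_left ((norm_sub_le _ _).trans
      (add_le_add_right ((norm_le_pi_norm χ 0).trans hχ') _)) hα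
  have h2 : ‖M.Jsharp q *ᵥ (χ 1 - G.α • (M.ψ q - χ 0))‖ ≤
      m * |cS| * (|Z| + G.α * (‖M.ψ q‖ + |Z|)) :=
    (norm_mulVec_le (hS q hq) _).trans (by gcongr)
  have h3 : ‖G.φ t q‖ ≤ |cφ| * (1 + ‖q‖) := (hφ t ht htT q).trans (by
    gcongr
    exact le_abs_self _)
  have h4 : ‖nullTerm M G t q‖ ≤ (1 + m * |cS| * (p * |cJ|)) * (|cφ| * (1 + ‖q‖)) := by
    rw [nullTerm, Matrix.sub_mulVec, Matrix.one_mulVec, ← Matrix.mulVec_mulVec]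
    refine (norm_sub_le _ _).trans ?_
    rw [add_mul, one_mul]
    have hJφ : ‖M.J q *ᵥ G.φ t q‖ ≤ p * |cJ| * (|cφ| * (1 + ‖q‖)) :=
      (norm_mulVec_le (hJ q hq) _).trans (by gcongr)
    refine add_le_add h3 ((norm_mulVec_le (hS q hq) _).trans ?_)
    rw [mul_assoc (m * |cS| : ℝ)]
    gcongr
  have h5 : |Z| + G.α * (‖M.ψ q‖ + |Z|) ≤ (|Z| + G.α * (1 + |Z|)) * (1 + ‖q‖ + ‖M.ψ q‖) := by
    have e : (|Z| + G.α * (1 + |Z|)) * (1 + ‖q‖ + ‖M.ψ q‖) = |Z| + G.α * (‖M.ψ q‖ + |Z|) +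
        (|Z| * (‖q‖ + ‖M.ψ q‖) + G.α * (1 + ‖q‖ + |Z| * (‖q‖ + ‖M.ψ q‖))) := by ring
    rw [e]
    exact le_add_of_nonneg_right (by positivity)
  have h6 : 1 + ‖q‖ ≤ 1 + ‖q‖ + ‖M.ψ q‖ := le_add_of_nonneg_right (norm_nonneg _)
  calc ‖refVel M G t q χ‖ ≤ m * |cS| * (|Z| + G.α * (‖M.ψ q‖ + |Z|)) +
        (1 + m * |cS| * (p * |cJ|)) * (|cφ| * (1 + ‖q‖)) :=
        (norm_add_le _ _).trans (add_le_add h2 h4)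
    _ ≤ m * |cS| * ((|Z| + G.α * (1 + |Z|)) * (1 + ‖q‖ + ‖M.ψ q‖)) +
        (1 + m * |cS| * (p * |cJ|)) * (|cφ| * (1 + ‖q‖ + ‖M.ψ q‖)) := by gcongr
    _ = _ := by ring

/-- A smooth measure of the joint and task-space positions. -/
noncomputable def posSize (M : Manipulator m p r) (q : Fin p → ℝ) : ℝ :=
  √(1 + q ⬝ᵥ q + M.ψ q ⬝ᵥ M.ψ q)

theorem dotProduct_self_nonneg' {k : ℕ} (x : Fin k → ℝ) : 0 ≤ x ⬝ᵥ x :=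
  Finset.sum_nonneg fun i _ => mul_self_nonneg (x i)

theorem norm_le_sqrt_of_dotProduct_le {k : ℕ} {x : Fin k → ℝ} {a : ℝ} (h : x ⬝ᵥ x ≤ a) :
    ‖x‖ ≤ √a := by
  refine (pi_norm_le_iff_of_nonneg (Real.sqrt_nonneg _)).2 fun i => Real.abs_le_sqrt ?_
  rw [sq]
  exact (Finset.single_le_sum (f := fun i => x i * x i) (fun i _ => mul_self_nonneg (x i))
    (Finset.mem_univ i)).trans h

theorem posSize_arg_pos (M : Manipulator m p r) (q : Fin p → ℝ) :
    0 < 1 + q ⬝ᵥ q + M.ψ q ⬝ᵥ M.ψ q := by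
  linarith [dotProduct_self_nonneg' q, dotProduct_self_nonneg' (M.ψ q)]

theorem one_le_posSize (M : Manipulator m p r) (q : Fin p → ℝ) : 1 ≤ posSize M q :=
  Real.one_le_sqrt.2 (by linarith [dotProduct_self_nonneg' q, dotProduct_self_nonneg' (M.ψ q)])

theorem norm_le_posSize (M : Manipulator m p r) (q : Fin p → ℝ) : ‖q‖ ≤ posSize M q :=
  norm_le_sqrt_of_dotProduct_le (by linarith [dotProduct_self_nonneg' (M.ψ q)])

theorem norm_forwardKinematics_le_posSize (M : Manipulator m p r) (q : Fin p → ℝ) :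
    ‖M.ψ q‖ ≤ posSize M q :=
  norm_le_sqrt_of_dotProduct_le (by linarith [dotProduct_self_nonneg' q])

theorem Manipulator.IsRegular.contDiff_posSize (hM : M.IsRegular t₀) :
    ContDiff ℝ 1 (posSize M) := by
  have hψ : ContDiff ℝ 1 M.ψ := hM.ψ_smooth.of_le (by norm_num)
  refine contDiff_iff_contDiffAt.2 fun q => ContDiffAt.sqrt ?_ (posSize_arg_pos M q).ne'
  exact (contDiffAt_const.add (contDiffAt_dotProduct contDiffAt_id contDiffAt_id)).add
    (contDiffAt_dotProduct hψ.contDiffAt hψ.contDiffAt)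

/-- Dividing by P in the derivative of the square root leaves a bound linear in the velocity alone.
The size includes ψ(q) because J is bounded only on `D`, which need not be convex, so ψ is not
controlled by ‖q‖. -/
theorem exists_posSize_deriv_le (hM : M.IsRegular t₀) :
    ∃ k, 0 ≤ k ∧ ∀ (q : ℝ → Fin p → ℝ) (v : Fin p → ℝ) (t : ℝ), HasDerivAt q v t → q t ∈ M.D →
      ∃ D, HasDerivAt (fun t => posSize M (q t)) D t ∧ D ≤ k * ‖v‖ := by
  obtain ⟨cJ, hJ⟩ := hM.J_bdd
  refine ⟨p + m * (p * |cJ|), by positivity, fun q v t hq hD => ?_⟩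
  have hx := hasDerivAt_forwardKinematics hM hq
  have hP := (((hasDerivAt_dotProduct hq hq).const_add 1).add
    (hasDerivAt_dotProduct hx hx)).sqrt (posSize_arg_pos M (q t)).ne'
  refine ⟨_, hP, ?_⟩
  have hpos : 0 < posSize M (q t) := one_pos.trans_le (one_le_posSize M _)
  have h1 : q t ⬝ᵥ v ≤ p * (posSize M (q t) * ‖v‖) :=
    (le_abs_self _).trans ((abs_dotProduct_le _ _).trans (by
      gcongr
      exact norm_le_posSize M _))
  have h2 : M.ψ (q t) ⬝ᵥ (M.J (q t) *ᵥ v) ≤ m * (posSize M (q t) * (p * |cJ| * ‖v‖)) :=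
    (le_abs_self _).trans ((abs_dotProduct_le _ _).trans (by
      gcongr
      · exact norm_forwardKinematics_le_posSize M _
      · exact norm_mulVec_le (hJ _ hD) v))
  change (v ⬝ᵥ q t + q t ⬝ᵥ v + (M.J (q t) *ᵥ v ⬝ᵥ M.ψ (q t) + M.ψ (q t) ⬝ᵥ M.J (q t) *ᵥ v)) /
    (2 * posSize M (q t)) ≤ _
  rw [div_le_iff₀ (by positivity), dotProduct_comm v, dotProduct_comm (M.J (q t) *ᵥ v)]
  linarith

theorem Manipulator.IsRegular.contDiffAt_energy (hM : M.IsRegular t₀)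
    (hG : G.IsAdmissible t₀) {x : ℝ × AgentState m p r} (hq : x.2.1.1 ∈ M.D) :
    ContDiffAt ℝ 1 (fun x : ℝ × AgentState m p r => energy M G x.1 x.2) x := by
  have hS := hM.contDiffAt_slide hG hq
  refine ContDiffAt.add (contDiffAt_const.mul (contDiffAt_dotProduct hS (contDiffAt_mulVec
    (A := fun x : ℝ × AgentState m p r => M.H x.2.1.1) (fun a b => ?_) hS)))
    (contDiffAt_const.mul (ContDiffAt.sum fun a _ => ?_))
  · exact ContDiffAt.comp x (g := fun q => M.H q a b) (hM.H_smooth a b).contDiffAt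
      (f := fun x : ℝ × AgentState m p r => x.2.1.1) (by fun_prop)
  · exact (ContDiffAt.pow (by fun_prop) 2).div_const _

theorem paramError_nonneg (hG : G.IsAdmissible t₀) (θ : Fin r → ℝ) :
    0 ≤ ∑ a, (θ a - M.ϑ a) ^ 2 / G.τ a :=
  Finset.sum_nonneg fun a _ => div_nonneg (sq_nonneg _) (hG.τ_pos a).le

theorem Manipulator.IsRegular.H_quadratic_nonneg (hM : M.IsRegular t₀) (q s : Fin p → ℝ) :
    0 ≤ s ⬝ᵥ (M.H q *ᵥ s) := by
  simpa using (hM.H_posDef q).posSemidef.dotProduct_mulVec_nonneg s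

theorem energy_nonneg (hM : M.IsRegular t₀) (hG : G.IsAdmissible t₀) (t : ℝ)
    (y : AgentState m p r) : 0 ≤ energy M G t y := by
  have h1 := hM.H_quadratic_nonneg y.1.1 (slide M G t y.1.1 y.1.2.1 y.2)
  have h2 := paramError_nonneg (M := M) hG y.1.2.2
  rw [energy]
  positivity

/-- `w` is a possible velocity of a manipulator in the state `y`, with the estimate and its
velocity bounded by `Z`. -/
def IsAgentVelocity (M : Manipulator m p r) (G : Controller m p r) (Z t : ℝ)
    (y w : AgentState m p r) : Prop :=
  w.1.1 = y.1.2.1 ∧ ‖w.2‖ ≤ Z ∧ ∀ s, s = slide M G t y.1.1 y.1.2.1 y.2 →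
    (M.H y.1.1 *ᵥ s) ⬝ᵥ w.1.2.1 + (fun a => (y.1.2.2 a - M.ϑ a) / G.τ a) ⬝ᵥ w.1.2.2 ≤
      s ⬝ᵥ (M.H y.1.1 *ᵥ refAcc M G t y.1.1 y.1.2.1 y.2
        - M.C y.1.1 y.1.2.1 *ᵥ s - ((M.J y.1.1)ᵀ * G.Kx * M.J y.1.1) *ᵥ s
        - G.Ks *ᵥ s - M.d t) + ∑ a, |(s ᵥ* G.Kr) a|

theorem exists_lyapunov_growth (hM : M.IsRegular t₀) (hG : G.IsAdmissible t₀) (T Z : ℝ) :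
    ∃ K, 0 ≤ K ∧ ∀ (y : ℝ → AgentState m p r) (w : AgentState m p r) (t : ℝ), t₀ ≤ t → t ≤ T →
      HasDerivAt y w t → (y t).1.1 ∈ M.D → ‖(y t).2‖ ≤ Z → IsAgentVelocity M G Z t (y t) w →
      ∀ D, HasDerivAt (fun t => posSize M (y t).1.1 + energy M G t (y t)) D t →
        D ≤ K * (posSize M (y t).1.1 + energy M G t (y t)) := by
  obtain ⟨c, μ, hμ, hdis⟩ := exists_energy_dissipation hM hG (2 * Z + G.α * (2 * Z))
  obtain ⟨k, hk, hgrow⟩ := exists_refVel_growth hM hG T Z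
  obtain ⟨l, hl, hpos⟩ := exists_posSize_deriv_le hM
  -- The first term is the maximum of (l + c)x - μx²; the 3 comes from 1, ‖q‖ and ‖ψ(q)‖, each at
  -- most P. The constant term is absorbed using P ≥ 1.
  refine ⟨(l + c) ^ 2 / (4 * μ) + l * (k * 3), by positivity, ?_⟩
  rintro y w t ht htT hy hD hZ ⟨hv, hwZ, hle⟩ D hQ
  obtain ⟨D₁, hD₁, hD₁le⟩ := hpos _ _ t hy.fst.fst hD
  have hE : HasDerivAt (fun t => energy M G t (y t)) (D - D₁) t :=
    (hQ.sub hD₁).congr_of_eventuallyEq (Eventually.of_forall fun s => by simp)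
  set s := slide M G t (y t).1.1 (y t).1.2.1 (y t).2 with hs
  have hE₁ := energy_deriv_le hM hG hy hD hv hs (hle s hs) hE
  have hcomp (χ : Triple m) (hχ : ‖χ‖ ≤ Z) (i : Fin 3) : ‖χ i‖ ≤ Z := (norm_le_pi_norm χ i).trans hχ
  have hX : ‖(w.2 1 - (y t).2 2) + G.α • (w.2 0 - (y t).2 1)‖ ≤ 2 * Z + G.α * (2 * Z) := by
    refine (norm_add_le _ _).trans (add_le_add ((norm_sub_le _ _).trans ?_) ?_)
    · linarith [hcomp _ hwZ 1, hcomp _ hZ 2]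
    · rw [norm_smul, Real.norm_of_nonneg hG.α_pos.le]
      refine mul_le_mul_of_nonneg_left ((norm_sub_le _ _).trans ?_) hG.α_pos.le
      linarith [hcomp _ hwZ 0, hcomp _ hZ 1]
  have hE₂ := hE₁.trans (hdis t ht _ hD _ hX s)
  have hvel : ‖w.1.1‖ ≤ ‖s‖ + k * (3 * posSize M (y t).1.1) := by
    have h1 : w.1.1 = s + refVel M G t (y t).1.1 (y t).2 := by
      rw [hv, hs, slide, sub_add_cancel]
    rw [h1]
    refine (norm_add_le _ _).trans (add_le_add_right ((hgrow t ht htT _ hD _ hZ).trans ?_) _)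
    gcongr
    linarith [one_le_posSize M (y t).1.1, norm_le_posSize M (y t).1.1,
      norm_forwardKinematics_le_posSize M (y t).1.1]
  have hquad : (l + c) * ‖s‖ - μ * ‖s‖ ^ 2 ≤ (l + c) ^ 2 / (4 * μ) := by
    rw [le_div_iff₀ (by positivity)]
    nlinarith [sq_nonneg (2 * μ * ‖s‖ - (l + c))]
  have hP := one_le_posSize M (y t).1.1
  have hEn := energy_nonneg hM hG t (y t)
  have h1 := mul_le_mul_of_nonneg_left hvel hl
  have hA : 0 ≤ (l + c) ^ 2 / (4 * μ) := by positivity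
  calc D ≤ (l + c) ^ 2 / (4 * μ) * 1 + l * (k * 3) * posSize M (y t).1.1 := by linarith
    _ ≤ (l + c) ^ 2 / (4 * μ) * (posSize M (y t).1.1 + energy M G t (y t)) +
        l * (k * 3) * (posSize M (y t).1.1 + energy M G t (y t)) := by
        gcongr <;> linarith
    _ = _ := by ring

theorem exists_initial_bound (hM : M.IsRegular t₀) (hG : G.IsAdmissible t₀) (R : ℝ) :
    ∃ Q, ∀ y : AgentState m p r, y.1.1 ∈ M.D → ‖y‖ ≤ R →
      posSize M y.1.1 + energy M G t₀ y ≤ Q := by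
  obtain ⟨k, hk, hgrow⟩ := exists_refVel_growth hM hG t₀ R
  obtain ⟨P, hP⟩ := (isCompact_closedBall (0 : Fin p → ℝ) R).exists_bound_of_continuousOn
    hM.contDiff_posSize.continuous.continuousOn
  obtain ⟨F, hF⟩ := (isCompact_closedBall (0 : Fin r → ℝ) R).exists_bound_of_continuousOn
    (f := fun θ => ∑ a, (θ a - M.ϑ a) ^ 2 / G.τ a) (by fun_prop)
  obtain ⟨cH, hH⟩ := hM.H_bdd
  let σ : ℝ := R + k * (1 + R + P)
  refine ⟨P + (1 / 2 * (p * (σ * (p * |cH| * σ))) + 1 / 2 * F), fun y hq hy => ?_⟩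
  have hyq : ‖y.1.1‖ ≤ R := (norm_fst_le _).trans ((norm_fst_le y).trans hy)
  have hyv : ‖y.1.2.1‖ ≤ R :=
    (norm_fst_le _).trans ((norm_snd_le y.1).trans ((norm_fst_le y).trans hy))
  have hyθ : ‖y.1.2.2‖ ≤ R :=
    (norm_snd_le _).trans ((norm_snd_le y.1).trans ((norm_fst_le y).trans hy))
  have hp := (le_abs_self _).trans (hP y.1.1 (by simpa using hyq))
  have hf := (le_abs_self _).trans (hF y.1.2.2 (by simpa using hyθ))
  have hs : ‖slide M G t₀ y.1.1 y.1.2.1 y.2‖ ≤ σ := by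
    refine (norm_sub_le _ _).trans (add_le_add hyv
      ((hgrow t₀ le_rfl le_rfl _ hq _ ((norm_snd_le y).trans hy)).trans ?_))
    gcongr
    exact (norm_forwardKinematics_le_posSize M _).trans hp
  have hquad : slide M G t₀ y.1.1 y.1.2.1 y.2 ⬝ᵥ (M.H y.1.1 *ᵥ slide M G t₀ y.1.1 y.1.2.1 y.2) ≤
      p * (σ * (p * |cH| * σ)) := by
    refine (le_abs_self _).trans ((abs_dotProduct_le _ _).trans ?_)
    have hσ : 0 ≤ σ := (norm_nonneg _).trans hs
    gcongr
    exact (norm_mulVec_le (hH _) _).trans (by gcongr)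
  rw [energy]
  linarith

theorem exists_agent_bound (hM : M.IsRegular t₀) (hG : G.IsAdmissible t₀) (T Z R : ℝ) :
    ∃ B, ∀ (t₁ : ℝ) (y : ℝ → AgentState m p r), t₀ ≤ t₁ → t₁ ≤ T →
      AbsolutelyContinuousOnInterval y t₀ t₁ → (∀ t ∈ Icc t₀ t₁, (y t).1.1 ∈ M.D) →
      (∀ t ∈ Icc t₀ t₁, ‖(y t).2‖ ≤ Z) → ‖y t₀‖ ≤ R →
      (∀ᵐ t ∂(volume : Measure ℝ), t ∈ Ioo t₀ t₁ →
        ∃ w, HasDerivAt y w t ∧ IsAgentVelocity M G Z t (y t) w) →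
      ∀ χ : Triple m, ‖χ‖ ≤ Z → ‖(y t₁).1.1‖ ≤ B ∧ ‖(y t₁).1.2.1‖ ≤ B ∧
        ‖slide M G t₁ (y t₁).1.1 (y t₁).1.2.1 χ‖ ≤ B := by
  obtain ⟨K, hK, hgrowth⟩ := exists_lyapunov_growth hM hG T Z
  obtain ⟨Q, hQ⟩ := exists_initial_bound hM hG R
  obtain ⟨k, hk, hrv⟩ := exists_refVel_growth hM hG T Z
  -- The Grönwall bound of P + E up to time T. It bounds q first, and only then is a uniform lower
  -- bound of H available, on the ball of radius ρ.
  let ρ : ℝ := Q * Real.exp (K * (T - t₀))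
  obtain ⟨h, hh, hlow⟩ := exists_quadratic_lower_bound
    (isCompact_closedBall (0 : Fin p → ℝ) ρ) hM.continuous_H hM.H_posDef
  refine ⟨ρ + (1 + 2 * ρ / h) + 2 * (k * (1 + ρ + ρ)), ?_⟩
  intro t₁ y ht hT hAC hD hZ hR hder χ hχ
  have huIcc : uIcc t₀ t₁ = Icc t₀ t₁ := uIcc_of_le ht
  have hQAC : AbsolutelyContinuousOnInterval
      (fun t => posSize M (y t).1.1 + energy M G t (y t)) t₀ t₁ := by
    refine ((absolutelyContinuousOnInterval_id t₀ t₁).prodMk hAC).comp_contDiffAt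
      (Φ := fun x : ℝ × AgentState m p r => posSize M x.2.1.1 + energy M G x.1 x.2)
      fun t ht => ContDiffAt.add ?_ (hM.contDiffAt_energy hG (hD t (huIcc ▸ ht)))
    exact ContDiffAt.comp _ hM.contDiff_posSize.contDiffAt
      (f := fun x : ℝ × AgentState m p r => x.2.1.1) (by fun_prop)
  have hexp := hQAC.le_mul_exp (K := K) ht (by
    filter_upwards [hder] with t h hm D hQD
    obtain ⟨w, hw, hvel⟩ := h hm
    have hmem := Ioo_subset_Icc_self hm
    exact hgrowth y w t hm.1.le (hm.2.le.trans hT) hw (hD t hmem) (hZ t hmem) hvel D hQD)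
  have hQ₀ := hQ (y t₀) (hD t₀ (left_mem_Icc.2 ht)) hR
  have hQpos : 0 ≤ Q := by
    linarith [one_le_posSize M (y t₀).1.1, energy_nonneg hM hG t₀ (y t₀)]
  have hρ : posSize M (y t₁).1.1 + energy M G t₁ (y t₁) ≤ ρ := by
    refine hexp.trans ?_
    simp only [ρ]
    gcongr
  have hD₁ := hD t₁ (right_mem_Icc.2 ht)
  have hE := energy_nonneg hM hG t₁ (y t₁)
  have hP : posSize M (y t₁).1.1 ≤ ρ := by linarith
  have hq : ‖(y t₁).1.1‖ ≤ ρ := (norm_le_posSize M _).trans hP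
  have hψ : ‖M.ψ (y t₁).1.1‖ ≤ ρ := (norm_forwardKinematics_le_posSize M _).trans hP
  have hρ₀ : 0 ≤ ρ := (norm_nonneg _).trans hq
  set s := slide M G t₁ (y t₁).1.1 (y t₁).1.2.1 (y t₁).2 with hs
  have hs₁ : h * ‖s‖ ^ 2 ≤ 2 * ρ := by
    have h1 := hlow _ (by simpa using hq) s
    have h2 := paramError_nonneg (M := M) hG (y t₁).1.2.2
    have h3 : energy M G t₁ (y t₁) = 1 / 2 * (s ⬝ᵥ (M.H (y t₁).1.1 *ᵥ s)) +
      1 / 2 * ∑ a, ((y t₁).1.2.2 a - M.ϑ a) ^ 2 / G.τ a := rfl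
    linarith [one_le_posSize M (y t₁).1.1]
  have hs₂ : ‖s‖ ≤ 1 + 2 * ρ / h := by
    have : ‖s‖ ^ 2 ≤ 2 * ρ / h := by
      rw [le_div_iff₀ hh]
      linarith
    -- From 2x ≤ 1 + x², avoiding a square root.
    nlinarith [sq_nonneg (‖s‖ - 1), norm_nonneg s]
  have hrv₁ (χ : Triple m) (hχ : ‖χ‖ ≤ Z) :
      ‖refVel M G t₁ (y t₁).1.1 χ‖ ≤ k * (1 + ρ + ρ) :=
    (hrv t₁ ht hT _ hD₁ χ hχ).trans (by gcongr)
  have hv : ‖(y t₁).1.2.1‖ ≤ (1 + 2 * ρ / h) + k * (1 + ρ + ρ) := by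
    have h1 : (y t₁).1.2.1 = s + refVel M G t₁ (y t₁).1.1 (y t₁).2 := by
      rw [hs, slide, sub_add_cancel]
    rw [h1]
    exact (norm_add_le _ _).trans (add_le_add hs₂ (hrv₁ _ (hZ t₁ (right_mem_Icc.2 ht))))
  have hkρ : 0 ≤ k * (1 + ρ + ρ) := by positivity
  have hρh : 0 ≤ 1 + 2 * ρ / h := by positivity
  refine ⟨by linarith, by linarith, (norm_sub_le _ _).trans ?_⟩
  linarith [hrv₁ χ hχ]

end Bounds

/-! ### The closed loop -/

section Loop

theorem mismatch_state {m p r : ℕ} (M : Manipulator m p r) (G : Controller m p r) (L : Leader m)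
    (t : ℝ) (q v : Fin p → ℝ) (θ : Fin r → ℝ) : mismatch M G L t q v θ (L.state t) = 0 := by
  simp [mismatch]

variable {n m : ℕ} {L : Leader m} {β : Fin 3 → ℝ} {t₀ : ℝ}

theorem exists_settlingTime (L : Leader m) (β : Fin 3 → ℝ) (t₀ : ℝ) (ζ₀ : Fin n → Triple m) :
    ∃ t_f : ℝ, t₀ < t_f ∧ (t₀ < settlingBound L β t₀ ζ₀ → t_f ≤ settlingBound L β t₀ ζ₀) ∧
      settlingBound L β t₀ ζ₀ ≤ t_f ∧ t_f ≤ max (settlingBound L β t₀ ζ₀) (t₀ + 1) := by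
  by_cases h : t₀ < settlingBound L β t₀ ζ₀
  · exact ⟨_, h, fun _ => le_rfl, le_rfl, le_max_left _ _⟩
  -- The settling time must exceed t₀; without a positive waiting time any later instant serves.
  · exact ⟨t₀ + 1, by linarith, fun h' => absurd h' h, by linarith, le_max_right _ _⟩

theorem le_settlingBound (hA : L.RateBound t₀ β) (ζ₀ : Fin n → Triple m) :
    t₀ ≤ settlingBound L β t₀ ζ₀ :=
  le_max_of_le_left (le_add_of_nonneg_right (div_nonneg
    (Real.iSup_nonneg fun _ => norm_nonneg _) (sub_pos.2 (hA 0).2).le))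

theorem settlingBound_le (hA : L.RateBound t₀ β) {ζ₀ : Fin n → Triple m} {R : ℝ}
    (hR : ‖ζ₀‖ ≤ R) :
    settlingBound L β t₀ ζ₀ ≤ t₀ + ∑ k, (R + ‖L.state t₀‖) / (β k - L.supRate t₀ k) := by
  have hR₀ : 0 ≤ R + ‖L.state t₀‖ := add_nonneg ((norm_nonneg _).trans hR) (norm_nonneg _)
  have hblock (k : Fin 3) : blockSettlingBound L β t₀ ζ₀ k ≤
      t₀ + ∑ k, (R + ‖L.state t₀‖) / (β k - L.supRate t₀ k) := by
    refine add_le_add_right (le_trans ?_ (Finset.single_le_sum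
      (f := fun k => (R + ‖L.state t₀‖) / (β k - L.supRate t₀ k))
      (fun k _ => div_nonneg hR₀ (sub_pos.2 (hA k).2).le) (Finset.mem_univ k))) _
    refine div_le_div_of_nonneg_right (Real.iSup_le (fun i => ?_) hR₀) (sub_pos.2 (hA k).2).le
    exact (norm_sub_le _ _).trans (add_le_add ((norm_le_pi_norm (ζ₀ i) k).trans
      ((norm_le_pi_norm ζ₀ i).trans hR)) (norm_le_pi_norm (L.state t₀) k))
  exact max_le (hblock 0) (max_le (hblock 1) (hblock 2))

theorem norm_estimate_le {ζ : ℝ → Triple m} (hβ : ∀ k, 0 ≤ β k) {t : ℝ} (ht : t₀ ≤ t)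
    (hAC : AbsolutelyContinuousOnInterval ζ t₀ t)
    (hder : ∀ᵐ s ∂(volume : Measure ℝ), s ∈ Ioo t₀ t →
      ∃ w, HasDerivAt ζ w s ∧ ∀ k c, |w k c| ≤ β k) :
    ‖ζ t‖ ≤ ‖ζ t₀‖ + (∑ k, β k) * (t - t₀) := by
  have hsum : 0 ≤ ∑ k, β k := Finset.sum_nonneg fun k _ => hβ k
  have hb : 0 ≤ ‖ζ t₀‖ + (∑ k, β k) * (t - t₀) :=
    add_nonneg (norm_nonneg _) (mul_nonneg hsum (sub_nonneg.2 ht))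
  refine (pi_norm_le_iff_of_nonneg hb).2 fun k => (pi_norm_le_iff_of_nonneg hb).2 fun c => ?_
  have hk : β k ≤ ∑ k, β k := Finset.single_le_sum (fun k _ => hβ k) (Finset.mem_univ k)
  have h₀ : |ζ t₀ k c| ≤ ‖ζ t₀‖ := (norm_le_pi_norm (ζ t₀ k) c).trans (norm_le_pi_norm (ζ t₀) k)
  have key (σ : ℝ) (hσ : |σ| = 1) : σ * ζ t k c - σ * ζ t₀ k c ≤ β k * (t - t₀) := by
    refine (hAC.comp_contDiffAt (Φ := fun χ : Triple m => σ * χ k c)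
      fun s _ => ContDiff.contDiffAt (by fun_prop)).sub_le_of_deriv_le ht ?_
    filter_upwards [hder] with s hs hm D hD
    obtain ⟨w, hw, hwb⟩ := hs hm
    rw [hD.unique ((hasDerivAt_pi.1 (hasDerivAt_pi.1 hw k) c).const_mul σ)]
    refine (le_abs_self _).trans ?_
    rw [abs_mul, hσ, one_mul]
    exact hwb k c
  have h1 := key 1 (by simp)
  have h2 := key (-1) (by simp)
  have h3 := mul_le_mul_of_nonneg_right hk (sub_nonneg.2 ht)
  rw [Real.norm_eq_abs, abs_le]
  have h4 := abs_le.1 h₀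
  constructor <;> linarith

variable {p r : Fin n → ℕ} {M : (i : Fin n) → Manipulator m (p i) (r i)}
  {G : (i : Fin n) → Controller m (p i) (r i)} {N : Network n}

/-- The projection of the closed loop onto the stacked estimates. -/
def estimateProj (n m : ℕ) (p r : Fin n → ℕ) : LoopState n m p r →L[ℝ] (Fin n → Triple m) :=
  ContinuousLinearMap.snd ℝ _ _

/-- The projection of the closed loop onto one manipulator and its estimate. -/
def agentProj (m : ℕ) (p r : Fin n → ℕ) (i : Fin n) :
    LoopState n m p r →L[ℝ] AgentState m (p i) (r i) :=
  ((ContinuousLinearMap.proj (R := ℝ)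
    (φ := fun i : Fin n => (Fin (p i) → ℝ) × (Fin (p i) → ℝ) × (Fin (r i) → ℝ)) i).comp
      (ContinuousLinearMap.fst ℝ _ _)).prod
    ((ContinuousLinearMap.proj (R := ℝ) (φ := fun _ : Fin n => Triple m) i).comp
      (ContinuousLinearMap.snd ℝ _ _))

theorem norm_agentProj_le (i : Fin n) (z : LoopState n m p r) : ‖agentProj m p r i z‖ ≤ ‖z‖ :=
  max_le ((norm_le_pi_norm z.1 i).trans (norm_fst_le z))
    ((norm_le_pi_norm z.2 i).trans (norm_snd_le z))

theorem isAgentVelocity_of_filippov (hM : ∀ i, (M i).IsRegular t₀)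
    (hG : ∀ i, (G i).IsAdmissible t₀) (hβ : ∀ k, 0 ≤ β k) {t : ℝ} {z w : LoopState n m p r}
    (hw : w ∈ filippov (loopField M G N L β) t z) (i : Fin n) (hD : (z.1 i).1 ∈ (M i).D)
    {Z : ℝ} (hZ : ∑ k, β k ≤ Z) :
    IsAgentVelocity (M i) (G i) Z t (agentProj m p r i z) (agentProj m p r i w) := by
  have hf (z' : LoopState n m p r) : (agentProj m p r i (loopField M G N L β t z')).1 =
      localField (M i) (G i) t (agentProj m p r i z').1 (agentProj m p r i z').2 := rfl
  refine ⟨filippov_agent_vel hw hf, ?_, fun s hs => ?_⟩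
  · have hZ₀ : 0 ≤ Z := (Finset.sum_nonneg fun k _ => hβ k).trans hZ
    refine (pi_norm_le_iff_of_nonneg hZ₀).2 fun k => (pi_norm_le_iff_of_nonneg hZ₀).2 fun c => ?_
    exact (filippov_estimator_abs_le (π := estimateProj n m p r) hβ hw (fun _ => rfl) i k c).trans
      ((Finset.single_le_sum (fun k _ => hβ k) (Finset.mem_univ k)).trans hZ)
  · exact filippov_agent_le (hM i) (hG i) hw hf (π := agentProj m p r i) rfl hD hs

theorem exists_loop_bound (hM : ∀ i, (M i).IsRegular t₀) (hG : ∀ i, (G i).IsAdmissible t₀)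
    (hL : L.IsTrajectory t₀) (hA : L.RateBound t₀ β) (T₁ R : ℝ) :
    ∃ B, ∀ (T : EReal) (z : ℝ → LoopState n m p r), IsLoopSolution M G N L β t₀ T z →
      ‖z t₀‖ ≤ R → ∀ t ∈ timeInterval t₀ T, t ≤ T₁ → ∀ i,
        ‖((z t).1 i).1‖ ≤ B ∧ ‖((z t).1 i).2.1‖ ≤ B ∧
          ‖slide (M i) (G i) t ((z t).1 i).1 ((z t).1 i).2.1 (L.state t)‖ ≤ B := by
  have hβ (k : Fin 3) : 0 ≤ β k := (hA.pos k).le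
  have hsum : 0 ≤ ∑ k, β k := Finset.sum_nonneg fun k _ => hβ k
  obtain ⟨Λ, hΛ⟩ := (isCompact_Icc (a := t₀) (b := T₁)).exists_bound_of_continuousOn
    (f := L.state) fun t ht => (hL t ht.1).continuousWithinAt.mono Icc_subset_Ici_self
  -- One bound for the velocities of the estimates, the leader's state and the estimates themselves
  -- up to `T₁`.
  let Z : ℝ := max (max (∑ k, β k) Λ) (R + (∑ k, β k) * (T₁ - t₀))
  choose B hB using fun i => exists_agent_bound (hM i) (hG i) T₁ Z R
  refine ⟨∑ i, |B i|, fun T z hz hR t ht htT i => ?_⟩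
  have hACz (s : ℝ) (hs : s ∈ Icc t₀ t) : AbsolutelyContinuousOnInterval z t₀ s :=
    hz.1.1 s (timeInterval_mono ht hs.1 hs.2)
  have hder (s : ℝ) (hs : s ∈ Icc t₀ t) : ∀ᵐ u ∂(volume : Measure ℝ), u ∈ Ioo t₀ s →
      ∃ w, w ∈ filippov (loopField M G N L β) u (z u) ∧ HasDerivAt z w u := by
    filter_upwards [hz.1.2] with u hu hm
    exact hu (timeInterval_mono ht hm.1.le (hm.2.le.trans hs.2))
  have hAC (s : ℝ) (hs : s ∈ Icc t₀ t) :
      AbsolutelyContinuousOnInterval (fun u => agentProj m p r i (z u)) t₀ s :=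
    (hACz s hs).comp_contDiffAt fun u _ => (agentProj m p r i).contDiff.contDiffAt
  have hζ (s : ℝ) (hs : s ∈ Icc t₀ t) : ‖(z s).2 i‖ ≤ Z := by
    refine (norm_estimate_le (ζ := fun u => (z u).2 i) hβ hs.1
      ((hAC s hs).comp_contDiffAt (Φ := Prod.snd) fun u _ => contDiffAt_snd) ?_).trans ?_
    · filter_upwards [hder s hs] with u hu hm
      obtain ⟨w, hw, hd⟩ := hu hm
      refine ⟨w.2 i, ((agentProj m p r i).hasFDerivAt.comp_hasDerivAt u hd).snd, fun k c => ?_⟩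
      exact filippov_estimator_abs_le (π := estimateProj n m p r) hβ hw (fun _ => rfl) i k c
    · refine le_trans (add_le_add ((norm_le_pi_norm (z t₀).2 i).trans
        ((norm_snd_le _).trans hR)) (mul_le_mul_of_nonneg_left ?_ hsum)) (le_max_right _ _)
      linarith [hs.2]
  have hBi : B i ≤ ∑ i, |B i| := (le_abs_self _).trans
    (Finset.single_le_sum (f := fun i => |B i|) (fun i _ => abs_nonneg _) (Finset.mem_univ i))
  have h := hB i t (fun u => agentProj m p r i (z u)) ht.1 htT (hAC t ⟨ht.1, le_rfl⟩)
    (fun s hs => hz.2 s (timeInterval_mono ht hs.1 hs.2) i) hζ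
    ((norm_agentProj_le i _).trans hR) (by
      filter_upwards [hder t ⟨ht.1, le_rfl⟩] with u hu hm
      obtain ⟨w, hw, hd⟩ := hu hm
      exact ⟨agentProj m p r i w, (agentProj m p r i).hasFDerivAt.comp_hasDerivAt u hd,
        isAgentVelocity_of_filippov hM hG hβ hw i
          (hz.2 u (timeInterval_mono ht hm.1.le hm.2.le) i)
          ((le_max_left _ _).trans (le_max_left _ _))⟩)
    (L.state t) ((hΛ t ⟨ht.1, htT⟩).trans ((le_max_right _ _).trans (le_max_left _ _)))
  exact ⟨h.1.trans hBi, h.2.1.trans hBi, h.2.2.trans hBi⟩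

end Loop

end MHM

/-! ### Assembly of the two claims -/

theorem theorem1 {n m : ℕ} {p r : Fin n → ℕ}
    (M : (i : Fin n) → MHM.Manipulator m (p i) (r i))
    (G : (i : Fin n) → MHM.Controller m (p i) (r i))
    (N : MHM.Network n) (L : MHM.Leader m) (β : Fin 3 → ℝ) (t₀ : ℝ)
    (hL : L.IsTrajectory t₀)
    (hA1 : N.LeaderReachesAll) (hA2 : L.RateBound t₀ β) :
    -- the estimator settles in finite time, and the mismatch term then vanishes
    (∀ ζ : ℝ → Fin n → MHM.Triple m,
      MHM.IsFilippovSolution (MHM.estimatorField N L β) t₀ ⊤ ζ →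
      (∀ t, MHM.settlingBound L β t₀ (ζ t₀) ≤ t → ∀ i, ζ t i = L.state t) ∧
      ∃ t_f : ℝ, t₀ < t_f ∧
        (t₀ < MHM.settlingBound L β t₀ (ζ t₀) → t_f ≤ MHM.settlingBound L β t₀ (ζ t₀)) ∧
        ∀ t, t_f ≤ t → ∀ i, ζ t i = L.state t ∧
          ∀ (q v : Fin (p i) → ℝ) (θ : Fin (r i) → ℝ),
            MHM.mismatch (M i) (G i) L t q v θ (ζ t i) = 0) ∧
    -- no escape before the settling time, uniformly in bounded sets of initial values
    ((∀ i, (M i).IsRegular t₀) → (∀ i, (G i).IsAdmissible t₀) →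
      ∀ R : ℝ, ∃ B : ℝ, ∀ (T : EReal) (z : ℝ → MHM.LoopState n m p r), (t₀ : EReal) < T →
        MHM.IsLoopSolution M G N L β t₀ T z → ‖z t₀‖ ≤ R →
        ∃ t_f : ℝ, t₀ < t_f ∧
          (t₀ < MHM.settlingBound L β t₀ (z t₀).2 →
            t_f ≤ MHM.settlingBound L β t₀ (z t₀).2) ∧
          (∀ t ∈ MHM.timeInterval t₀ T, t_f ≤ t → ∀ i,
            (z t).2 i = L.state t ∧
            MHM.mismatch (M i) (G i) L t ((z t).1 i).1 ((z t).1 i).2.1 ((z t).1 i).2.2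
              ((z t).2 i) = 0) ∧
          ∀ t ∈ MHM.timeInterval t₀ T, t < t_f → ∀ i,
            ‖((z t).1 i).1‖ ≤ B ∧ ‖((z t).1 i).2.1‖ ≤ B ∧
            ‖MHM.slide (M i) (G i) t ((z t).1 i).1 ((z t).1 i).2.1 (L.state t)‖ ≤ B) := by
  have settle {T : EReal} {ζ : ℝ → Fin n → MHM.Triple m} (hζ : MHM.IsSlidingCurve N L β t₀ T ζ)
      {t : ℝ} (ht : t ∈ MHM.timeInterval t₀ T) (hst : MHM.settlingBound L β t₀ (ζ t₀) ≤ t)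
      (i : Fin n) : ζ t i = L.state t := hζ.eq_state hL hA1 hA2 ht hst i
  constructor
  · intro ζ hζ
    have hsl : MHM.IsSlidingCurve N L β t₀ ⊤ ζ :=
      hζ.isSlidingCurve (π := ContinuousLinearMap.id ℝ _) fun _ _ => rfl
    have hfinal (t : ℝ) (ht₀ : t₀ ≤ t) (ht : MHM.settlingBound L β t₀ (ζ t₀) ≤ t) (i : Fin n) :
        ζ t i = L.state t := settle hsl ⟨ht₀, EReal.coe_lt_top t⟩ ht i
    obtain ⟨t_f, h₀, hle, hge, -⟩ := MHM.exists_settlingTime L β t₀ (ζ t₀)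
    refine ⟨fun t ht => hfinal t ((MHM.le_settlingBound hA2 _).trans ht) ht, t_f, h₀, hle,
      fun t ht i => ?_⟩
    have heq := hfinal t (h₀.le.trans ht) (hge.trans ht) i
    exact ⟨heq, fun q v θ => by rw [heq, MHM.mismatch_state]⟩
  · intro hM hG R
    -- The horizon dominates every settling time arising from initial data bounded by R, so B
    -- depends neither on the solution nor on T.
    obtain ⟨B, hB⟩ := MHM.exists_loop_bound (N := N) hM hG hL hA2
      (max (t₀ + ∑ k, (R + ‖L.state t₀‖) / (β k - L.supRate t₀ k)) (t₀ + 1)) R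
    refine ⟨B, fun T z _ hz hR => ?_⟩
    have hsl : MHM.IsSlidingCurve N L β t₀ T fun t => (z t).2 :=
      hz.1.isSlidingCurve (π := MHM.estimateProj n m p r) fun _ _ => rfl
    obtain ⟨t_f, h₀, hle, hge, hmax⟩ := MHM.exists_settlingTime L β t₀ (z t₀).2
    refine ⟨t_f, h₀, hle, fun t ht htf i => ?_, fun t ht htf i => ?_⟩
    · have heq := settle hsl ht (hge.trans htf) i
      exact ⟨heq, by rw [heq, MHM.mismatch_state]⟩
    · refine hB T z hz hR t ht (htf.le.trans (hmax.trans (max_le_max_right _ ?_))) i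
      exact MHM.settlingBound_le hA2 ((norm_snd_le _).trans hR)
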